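/- Let $0\le k\le n$, let $a=\frac{i}{2}\,\mathrm{diag}(I_k,-I_{n-k})$, and let $M=\{UaU^{-1}: U\in U(n)\}\subset u(n)$ be the adjoint orbit of $a$, i.e. $Gr(k,n)$. Let $u(n)_a=\{y\in u(n):[y,a]=0\}$ and let $u(n)_a^\perp$ be its orthogonal complement in $u(n)$ with respect to $\langle x,y\rangle=-\mathrm{tr}(xy)$; its elements are the matrices $u=\begin{pmatrix}0&q\\-q^*&0\end{pmatrix}$ with $q\in\mathbb C^{k\times(n-k)}$. Let $C_a(\mathbb R,M)$ be the set of smooth paths $\gamma:\mathbb R\to M$ with $\lim_{x\to-\infty}\gamma(x)=a$ and $\gamma_x$ in the Schwartz class, and let $\mathcal S(\mathbb R,u(n)_a^\perp)$ be the space of Schwartz maps $\mathbb R\to u(n)_a^\perp$. For every $\gamma\in C_a(\mathbb R,M)$ there is exactly one $u\in\mathcal S(\mathbb R,u(n)_a^\perp)$ for which there is a smooth $g:\mathbb R\to U(n)$ with $\gamma=gag^{-1}$, $g^{-1}g_x=u$ and $\lim_{x\to-\infty}g(x)=I$, and the development map $\Phi:C_a(\mathbb R,M)\to\mathcal S(\mathbb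 R,u(n)_a^\perp)$, $\Phi(\gamma)=u$, is a bijection. Under $\Phi$ the flow of the GNLS $$\gamma_t=[\gamma,\gamma_{xx}]$$ corresponds to the flow of the MNLS $$u_t=(Q_2)_x+[u,Q_2],\qquad Q_2=\begin{pmatrix}-iqq^*&iq_x\\ iq_x^*&iq^*q\end{pmatrix},$$ that is: for every open set $J\subset\mathbb R$ of times (for example an open interval, or $\mathbb R$) and every family $\gamma(\cdot,t)\in C_a(\mathbb R,M)$, $t\in J$, the family $\gamma$ is a solution of the GNLS on $J$ if and only if $u(\cdot,t)=\Phi(\gamma(\cdot,t))$, $t\in J$, is a solution of the MNLS on $J$. Here a solution of the GNLS (resp. the MNLS) on $J$ is a family in $C_a(\mathbb R,M)$ (resp. $\mathcal S(\mathbb R,u(n)_a^\perp)$) which is smooth in $(x,t)$, satisfies the equation for all $x\in\mathbb R$, $t\in J$, and for which $\gamma_x(\cdot,t)$ (resp. $u(\cdot,t)$) stays bounded in every Schwartz seminorm for $t$ in compact subsets of $J$. -/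

import Mathlib

open Matrix Filter Topology Set
open scoped ContDiff SchwartzMap

attribute [local instance] Matrix.frobeniusNormedAddCommGroup Matrix.frobeniusNormedSpace

/-- Complex `n × n` matrices, `n = k + m`, with rows and columns split into blocks of sizes `k`
and `m = n - k`. The norm is the Frobenius norm, which on `u(n)` is the norm of the invariant
inner product `⟨x, y⟩ = -tr (x y)`. -/
abbrev GrMat (k m : ℕ) : Type := Matrix (Fin k ⊕ Fin m) (Fin k ⊕ Fin m) ℂ

namespace GrMat

variable (k m : ℕ)

/-- The base point `a = (i/2) diag (I_k, -I_m)`. -/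
noncomputable def base : GrMat k m :=
  (Complex.I / 2) • Matrix.fromBlocks 1 0 0 (-1)

/-- The Lie algebra `u(n)` of skew-Hermitian matrices. -/
def unitaryAlgebra : Set (GrMat k m) := {y | yᴴ = -y}

/-- `u(n)_a`, the centralizer of `a` in `u(n)`. -/
def centralizer : Set (GrMat k m) := {y | y ∈ unitaryAlgebra k m ∧ ⁅y, base k m⁆ = 0}

/-- `u(n)_a^⊥`, the orthogonal complement of `u(n)_a` in `u(n)` for `⟨x, y⟩ = -tr (x y)`. -/
def centralizerPerp : Set (GrMat k m) :=
  {y | y ∈ unitaryAlgebra k m ∧ ∀ z ∈ centralizer k m, -(y * z).trace = 0}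

/-- `M = Gr(k, n)`, the adjoint `U(n)`-orbit of `a`; `Uᴴ = U⁻¹` for unitary `U`. -/
def orbit : Set (GrMat k m) :=
  {y | ∃ U ∈ Matrix.unitaryGroup (Fin k ⊕ Fin m) ℂ, y = U * base k m * Uᴴ}

end GrMat

/-- `C_a(ℝ, M)`: smooth paths `γ : ℝ → M` with `γ(-∞) = a` and `γ_x` in the Schwartz class. -/
structure GrPath (k m : ℕ) where
  toFun : ℝ → GrMat k m
  smooth : ContDiff ℝ ∞ toFun
  mem_orbit : ∀ x, toFun x ∈ GrMat.orbit k m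
  tendsto_atBot : Tendsto toFun atBot (𝓝 (GrMat.base k m))
  deriv_schwartz : ∃ f : 𝓢(ℝ, GrMat k m), ∀ x, f x = deriv toFun x

/-- `𝒮(ℝ, u(n)_a^⊥)`: Schwartz maps with values in `u(n)_a^⊥`. -/
def PerpSchwartz (k m : ℕ) : Type :=
  {f : 𝓢(ℝ, GrMat k m) // ∀ x, f x ∈ GrMat.centralizerPerp k m}

instance (k m : ℕ) : CoeFun (GrPath k m) (fun _ => ℝ → GrMat k m) := ⟨GrPath.toFun⟩

noncomputable instance (k m : ℕ) : CoeFun (PerpSchwartz k m) (fun _ => ℝ → GrMat k m) := ⟨fun u => ⇑u.1⟩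

instance (k m : ℕ) : Nonempty (PerpSchwartz k m) :=
  ⟨⟨0, fun x => by
    simp [GrMat.centralizerPerp, GrMat.unitaryAlgebra]⟩⟩

/-- `γ = Ψ(u)`: there is a smooth `g : ℝ → U(n)` with `g⁻¹ g_x = u`, `g(-∞) = I` and
`γ = g a g⁻¹`, where `g⁻¹ = gᴴ`. -/
def IsDevelopment {k m : ℕ} (γ : GrPath k m) (u : PerpSchwartz k m) : Prop :=
  ∃ g : ℝ → GrMat k m, ContDiff ℝ ∞ g ∧
    (∀ x, g x ∈ Matrix.unitaryGroup (Fin k ⊕ Fin m) ℂ) ∧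
    Tendsto g atBot (𝓝 1) ∧
    (∀ x, (g x)ᴴ * deriv g x = u x) ∧
    (∀ x, γ x = g x * GrMat.base k m * (g x)ᴴ)

/-- The development map `Φ = Ψ⁻¹ : C_a(ℝ, M) → 𝒮(ℝ, u(n)_a^⊥)`: `Φ(γ)` is the `u` with
`Ψ(u) = γ`. -/
noncomputable def developmentMap {k m : ℕ} (γ : GrPath k m) : PerpSchwartz k m :=
  Classical.epsilon (fun u => IsDevelopment γ u)

/-- The family `f t`, `t ∈ J`, is bounded in the Schwartz topology, locally uniformly in `t`. -/
def LocallyBoundedSchwartz {k m : ℕ} (J : Set ℝ) (f : ℝ → ℝ → GrMat k m) : Prop :=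
  ∀ K ⊆ J, IsCompact K → ∀ p l : ℕ, ∃ C : ℝ, ∀ t ∈ K, ∀ x : ℝ,
    |x| ^ p * ‖iteratedDeriv l (f t) x‖ ≤ C

/-- The curve `t ↦ γ t` in `C_a(ℝ, M)`, `t ∈ J`, solves the GNLS `γ_t = [γ, γ_xx]`: it is smooth in
`(t, x)`, `γ_x` stays bounded in the Schwartz topology for `t` in compact subsets of `J`, and the
equation holds. -/
structure IsGNLSSolution {k m : ℕ} (J : Set ℝ) (γ : ℝ → GrPath k m) : Prop where
  smooth : ContDiffOn ℝ ∞ (fun p : ℝ × ℝ => γ p.1 p.2) (J ×ˢ univ)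
  bounded : LocallyBoundedSchwartz J (fun t => deriv (γ t))
  equation : ∀ t ∈ J, ∀ x : ℝ,
    HasDerivAt (fun s => γ s x) ⁅γ t x, iteratedDeriv 2 (γ t) x⁆ t

/-- `Q₂ = [[-i q q*, i q_x], [i q_x*, i q* q]]` for `u = [[0, q], [-q*, 0]]`. -/
noncomputable def Q2 {k m : ℕ} (u : ℝ → GrMat k m) (x : ℝ) : GrMat k m :=
  let q : ℝ → Matrix (Fin k) (Fin m) ℂ := fun y => (u y).toBlocks₁₂
  Matrix.fromBlocks (-(Complex.I • (q x * (q x)ᴴ))) (Complex.I • deriv q x)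
    (Complex.I • (deriv q x)ᴴ) (Complex.I • ((q x)ᴴ * q x))

/-- The curve `t ↦ u t` in `𝒮(ℝ, u(n)_a^⊥)`, `t ∈ J`, solves the MNLS `u_t = (Q₂)_x + [u, Q₂]`: it
is smooth in `(t, x)`, stays bounded in the Schwartz topology for `t` in compact subsets of `J`,
and the equation holds. -/
structure IsMNLSSolution {k m : ℕ} (J : Set ℝ) (u : ℝ → PerpSchwartz k m) : Prop where
  smooth : ContDiffOn ℝ ∞ (fun p : ℝ × ℝ => u p.1 p.2) (J ×ˢ univ)
  bounded : LocallyBoundedSchwartz J (fun t => u t)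
  equation : ∀ t ∈ J, ∀ x : ℝ,
    HasDerivAt (fun s => u s x) (deriv (Q2 (u t)) x + ⁅u t x, Q2 (u t) x⁆) t

/-! Since a² = -1/4, the space u(n)_a^⊥ consists of the skew matrices anticommuting with a
(`mem_centralizerPerp_iff`), and γ² = -1/4 on M. Everything analytic can then be done in a normed
star algebra, with Q₂ = 2a(u_x + u²) (`Q2_eq_frameGenerator`).

Development. If γ = g a g⁻¹ with g_x = g u, then [γ, γ_x] = g u g⁻¹, so g⁻¹ is the frame of the
connection -[γ, γ_x] equal to 1 at -∞. That connection depends on γ alone, hence γ determines g and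
u. Conversely, solving for this frame h (`IsFrame.exists_of_norm_le`) makes h γ h⁻¹ constant, equal
to its limit a, and u = h [γ, γ_x] h⁻¹ is Schwartz because h is bounded with all its derivatives.

Flows. The analytic core is `hasDerivAt_of_zeroCurvature`: zero curvature u_t = Q_x + [u, Q] with Q
→ 0 at -∞ forces g_t = g Q, although nothing is known beforehand about the dependence of g on t.
From the MNLS, Q = Q₂ gives γ_t = g [Q₂, a] g⁻¹ = g u_x g⁻¹ = [γ, γ_xx]. From the GNLS, u is not yet
known to be differentiable in t, so the pair A = [γ, γ_x], B = 6γγ_x² - γ_xx is used instead: it has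
zero curvature by `zeroCurvature_identity`, which gives (g⁻¹)_t = -g⁻¹B, and conjugating back u =
g⁻¹ A g yields the MNLS. Joint smoothness and Schwartz bounds pass between γ and u through the
linear equations satisfied by g. -/

open MeasureTheory

/-! ### Linear equations normalized at -∞ -/

section LinearODE

variable {A : Type*} [NormedRing A]

theorem integrable_of_norm_le_inv_one_add_sq {f : ℝ → A} (hf : Continuous f) {C : ℝ}
    (hC : ∀ x, ‖f x‖ ≤ C * (1 + x ^ 2)⁻¹) : Integrable f :=
  (integrable_inv_one_add_sq.const_mul C).mono' hf.aestronglyMeasurable (.of_forall hC)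

variable [NormedAlgebra ℝ A]

theorem hasDerivAt_integral_Iic [CompleteSpace A] {f : ℝ → A} (hf : Continuous f)
    (hi : Integrable f) (x : ℝ) : HasDerivAt (fun x => ∫ y in Iic x, f y) (f x) x := by
  have h1 : (fun x => ∫ y in Iic x, f y) = fun x => (∫ y in Iic 0, f y) + ∫ y in (0)..x, f y := by
    funext x
    rw [← intervalIntegral.integral_Iic_sub_Iic hi.integrableOn hi.integrableOn]
    abel
  rw [h1]
  exact (intervalIntegral.integral_hasDerivAt_right (hf.intervalIntegrable _ _)
    (hf.stronglyMeasurableAtFilter _ _) hf.continuousAt).const_add _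

theorem norm_integral_Iic_le {f : ℝ → A} {C : ℝ} (hC : ∀ x, ‖f x‖ ≤ C * (1 + x ^ 2)⁻¹) (x : ℝ) :
    ‖∫ y in Iic x, f y‖ ≤ C * (Real.arctan x + Real.pi / 2) := by
  have h := norm_integral_le_of_norm_le (μ := volume.restrict (Iic x))
    ((integrable_inv_one_add_sq.const_mul C).integrableOn) (.of_forall hC)
  rwa [integral_const_mul, integral_Iic_inv_one_add_sq] at h

theorem tendsto_integral_Iic_atBot {f : ℝ → A} {C : ℝ}
    (hC : ∀ x, ‖f x‖ ≤ C * (1 + x ^ 2)⁻¹) :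
    Tendsto (fun x => ∫ y in Iic x, f y) atBot (𝓝 0) := by
  refine squeeze_zero_norm (norm_integral_Iic_le hC) ?_
  have h : Tendsto Real.arctan atBot (𝓝 (-(Real.pi / 2))) :=
    Real.tendsto_arctan_atBot.mono_right nhdsWithin_le_nhds
  simpa using (h.add_const (Real.pi / 2)).const_mul C

/-- The linear equation `g' = g u` with integrable coefficient has a solution equal to `1`
at `-∞`. -/
theorem exists_linearODE_solution_atBot [CompleteSpace A] {u : ℝ → A} (hu : Continuous u) {C : ℝ}
    (hC : ∀ x, ‖u x‖ ≤ C * (1 + x ^ 2)⁻¹) :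
    ∃ g : ℝ → A, (∀ x, HasDerivAt g (g x * u x) x) ∧ Tendsto g atBot (𝓝 1) := by
  have hC0 : 0 ≤ C := by simpa using (norm_nonneg _).trans (hC 0)
  -- Bielecki weight: w' = 2w·C/(1+x²), so the integral of w·C/(1+y²) up to x is at most w(x)/2. The
  -- Volterra operator then contracts by 1/2 however large C is. As w lies between r and R, the
  -- weighted sup norm is equivalent to the usual one.
  let w : ℝ → ℝ := fun x => Real.exp (2 * C * Real.arctan x)
  have hwc : Continuous w := by fun_prop
  have hw0 : ∀ x, 0 < w x := fun x => Real.exp_pos _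
  let R : ℝ := Real.exp (2 * C * (Real.pi / 2))
  let r : ℝ := Real.exp (2 * C * -(Real.pi / 2))
  have hwR : ∀ x, w x ≤ R := fun x => Real.exp_le_exp.2
    (mul_le_mul_of_nonneg_left (Real.arctan_lt_pi_div_two x).le (by positivity))
  have hwr : ∀ x, r ≤ w x := fun x => Real.exp_le_exp.2
    (mul_le_mul_of_nonneg_left (Real.neg_pi_div_two_lt_arctan x).le (by positivity))
  have hr0 : 0 < r := Real.exp_pos _
  have hwd : ∀ x, HasDerivAt w (2 * (w x * (C * (1 + x ^ 2)⁻¹))) x := fun x => by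
    have h := ((Real.hasDerivAt_arctan' x).const_mul (2 * C)).exp
    convert h using 1
    simp only [w]; ring
  have hwi : ∀ x, Integrable (fun x => w x * (C * (1 + x ^ 2)⁻¹)) (volume.restrict (Iic x)) :=
    fun x => Integrable.integrableOn <| by
      refine (integrable_inv_one_add_sq.const_mul (R * C)).mono'
        (hwc.mul (continuous_const.mul (Continuous.inv₀ (by fun_prop)
          fun x => by positivity))).aestronglyMeasurable (.of_forall fun x => ?_)
      rw [Real.norm_of_nonneg (by have := hw0 x; positivity), mul_assoc]
      exact mul_le_mul_of_nonneg_right (hwR x) (by positivity)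
  have hwint : ∀ x, ∫ y in Iic x, w y * (C * (1 + y ^ 2)⁻¹) ≤ w x / 2 := fun x => by
    have hl : Tendsto w atBot (𝓝 r) := by
      have h : Tendsto Real.arctan atBot (𝓝 (-(Real.pi / 2))) :=
        Real.tendsto_arctan_atBot.mono_right nhdsWithin_le_nhds
      exact (Real.continuous_exp.tendsto _).comp (h.const_mul (2 * C))
    have h := integral_Iic_of_hasDerivAt_of_tendsto' (a := x) (fun x _ => hwd x)
      ((hwi x).const_mul 2) hl
    rw [integral_const_mul] at h
    linarith
  have hfc : ∀ h : BoundedContinuousFunction ℝ A, Continuous fun y => w y • (h y * u y) :=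
    fun h => hwc.smul (h.continuous.mul hu)
  have hfle : ∀ (h : BoundedContinuousFunction ℝ A) y,
      ‖w y • (h y * u y)‖ ≤ ‖h‖ * (w y * (C * (1 + y ^ 2)⁻¹)) := fun h y => by
    rw [norm_smul, Real.norm_of_nonneg (hw0 y).le, mul_left_comm]
    refine mul_le_mul_of_nonneg_left ((norm_mul_le _ _).trans ?_) (hw0 y).le
    exact mul_le_mul (h.norm_coe_le_norm y) (hC y) (norm_nonneg _) (norm_nonneg _)
  have hfle' : ∀ (h : BoundedContinuousFunction ℝ A) y,
      ‖w y • (h y * u y)‖ ≤ ‖h‖ * R * C * (1 + y ^ 2)⁻¹ := fun h y => by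
    refine (hfle h y).trans ?_
    rw [mul_assoc, mul_assoc]
    exact mul_le_mul_of_nonneg_left (mul_le_mul_of_nonneg_right (hwR y) (by positivity))
      (norm_nonneg _)
  have hfi := fun h => integrable_of_norm_le_inv_one_add_sq (hfc h) (hfle' h)
  have hint : ∀ (h : BoundedContinuousFunction ℝ A) x,
      ‖(w x)⁻¹ • ∫ y in Iic x, w y • (h y * u y)‖ ≤ ‖h‖ / 2 := fun h x => by
    rw [norm_smul, norm_inv, Real.norm_of_nonneg (hw0 x).le]
    have h1 := norm_integral_le_of_norm_le (μ := volume.restrict (Iic x))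
      ((hwi x).const_mul ‖h‖) (.of_forall (hfle h))
    rw [integral_const_mul] at h1
    rw [inv_mul_le_iff₀ (hw0 x)]
    refine h1.trans ((mul_le_mul_of_nonneg_left (hwint x) (norm_nonneg h)).trans_eq ?_)
    ring
  -- This is the map g ↦ 1 + ∫ g u written for the rescaled unknown h = w⁻¹ g.
  let T : BoundedContinuousFunction ℝ A → BoundedContinuousFunction ℝ A := fun h =>
    BoundedContinuousFunction.ofNormedAddCommGroup
      (fun x => (w x)⁻¹ • (1 : A) + (w x)⁻¹ • ∫ y in Iic x, w y • (h y * u y))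
      (by
        have h1 : Continuous fun x => ∫ y in Iic x, w y • (h y * u y) :=
          continuous_iff_continuousAt.2 fun x =>
            (hasDerivAt_integral_Iic (hfc h) (hfi h) x).continuousAt
        have h2 : Continuous fun x => (w x)⁻¹ := hwc.inv₀ fun x => (hw0 x).ne'
        exact (h2.smul continuous_const).add (h2.smul h1))
      (r⁻¹ * ‖(1 : A)‖ + ‖h‖ / 2)
      (fun x => by
        refine (norm_add_le _ _).trans (add_le_add ?_ (hint h x))
        rw [norm_smul, norm_inv, Real.norm_of_nonneg (hw0 x).le]
        exact mul_le_mul_of_nonneg_right (inv_anti₀ hr0 (hwr x)) (norm_nonneg _))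
  have hT : ContractingWith (1 / 2) T := by
    refine ⟨NNReal.half_lt_self one_ne_zero, LipschitzWith.of_dist_le_mul fun h h' => ?_⟩
    rw [BoundedContinuousFunction.dist_le (by positivity)]
    intro x
    have h1 := hint (h - h') x
    rw [dist_eq_norm, dist_eq_norm]
    have h2 : T h x - T h' x = (w x)⁻¹ • ∫ y in Iic x, w y • ((h - h') y * u y) := by
      simp only [T, BoundedContinuousFunction.coe_ofNormedAddCommGroup,
        BoundedContinuousFunction.coe_sub, Pi.sub_apply, sub_mul, smul_sub]
      rw [integral_sub (hfi h).integrableOn (hfi h').integrableOn, smul_sub]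
      abel
    rw [h2]
    refine h1.trans_eq ?_
    push_cast
    ring
  let h := hT.fixedPoint T
  have hfix : T h = h := hT.fixedPoint_isFixedPt
  let g : ℝ → A := fun x => w x • h x
  have hg : ∀ x, g x = 1 + ∫ y in Iic x, w y • (h y * u y) := fun x => by
    change w x • h x = _
    conv_lhs => rw [← hfix]
    simp only [T, BoundedContinuousFunction.coe_ofNormedAddCommGroup]
    rw [← smul_add, smul_inv_smul₀ (hw0 x).ne']
  refine ⟨g, fun x => ?_, ?_⟩
  · rw [funext hg]
    have h1 := (hasDerivAt_integral_Iic (hfc h) (hfi h) x).const_add 1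
    refine h1.congr_deriv ?_
    beta_reduce
    rw [← hg x, smul_mul_assoc]
  · rw [funext hg]
    simpa using (tendsto_integral_Iic_atBot (hfle' h)).const_add 1

end LinearODE

/-! ### Time derivative of a frame under zero curvature -/

section TimeDerivative

variable {A : Type*} [NormedRing A]

theorem norm_mul_mul_le_of_le {a b c : A} {α β κ : ℝ} (ha : ‖a‖ ≤ α) (hb : ‖b‖ ≤ β)
    (hc : ‖c‖ ≤ κ) : ‖a * b * c‖ ≤ α * β * κ :=
  (norm_mul_le _ _).trans (mul_le_mul ((norm_mul_le _ _).trans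
    (mul_le_mul ha hb (norm_nonneg _) ((norm_nonneg _).trans ha))) hc (norm_nonneg _)
    (mul_nonneg ((norm_nonneg _).trans ha) ((norm_nonneg _).trans hb)))

variable [NormedAlgebra ℝ A]

/-- If `g_x = g u`, `g = 1` at `-∞` and the zero curvature equation `u_t = Q_x + [u, Q]` holds with
all terms dominated, then `g_t = g Q`. -/
theorem hasDerivAt_of_zeroCurvature [CompleteSpace A] {u g h v : ℝ → ℝ → A} {Q : ℝ → A}
    {t ε C : ℝ} (hε : 0 < ε) (huc : ∀ s, Continuous (u s))
    (hg : ∀ s y, HasDerivAt (g s) (g s y * u s y) y)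
    (hh : ∀ s y, HasDerivAt (h s) (-(u s y * h s y)) y)
    (hgC : ∀ s y, ‖g s y‖ ≤ C) (hhC : ∀ s y, ‖h s y‖ ≤ C)
    (hhg : ∀ s y, h s y * g s y = 1) (hgh : ∀ s y, g s y * h s y = 1)
    (hg1 : ∀ s, Tendsto (g s) atBot (𝓝 1)) (hh1 : ∀ s, Tendsto (h s) atBot (𝓝 1))
    (hu : ∀ s ∈ Metric.ball t ε, ∀ y, HasDerivAt (fun s => u s y) (v s y) s)
    (hv : ∀ s ∈ Metric.ball t ε, ∀ y, ‖v s y‖ ≤ C * (1 + y ^ 2)⁻¹) (hvc : Continuous (v t))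
    (hQ : ∀ y, HasDerivAt Q (v t y - (u t y * Q y - Q y * u t y)) y)
    (hQ0 : Tendsto Q atBot (𝓝 0)) (x : ℝ) :
    HasDerivAt (fun s => g s x) (g t x * Q x) t := by
  have ht : t ∈ Metric.ball t ε := Metric.mem_ball_self hε
  have hgc : ∀ s, Continuous (g s) := fun s =>
    continuous_iff_continuousAt.2 fun y => (hg s y).continuousAt
  have hhc : ∀ s, Continuous (h s) := fun s =>
    continuous_iff_continuousAt.2 fun y => (hh s y).continuousAt
  have hlip : ∀ s ∈ Metric.ball t ε, ∀ y,
      ‖u s y - u t y‖ ≤ |s - t| * C * (1 + y ^ 2)⁻¹ := fun s hs y => by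
    have h1 := (convex_ball t ε).norm_image_sub_le_of_norm_hasDerivWithin_le
      (fun s hs => (hu s hs y).hasDerivWithinAt) (fun s hs => hv s hs y) ht hs
    refine h1.trans_eq ?_
    rw [Real.norm_eq_abs]; ring
  -- Duhamel formula: F s is the x-derivative of g(s) g(t)⁻¹, so its integral from -∞ measures g(s)
  -- g(t)⁻¹ - 1 without any regularity of g in time.
  let F : ℝ → ℝ → A := fun s y => g s y * (u s y - u t y) * h t y
  have hFc : ∀ s, Continuous (F s) := fun s =>
    ((hgc s).mul ((huc s).sub (huc t))).mul (hhc t)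
  have hFle : ∀ s ∈ Metric.ball t ε, ∀ y, ‖F s y‖ ≤ |s - t| * (C * C * C) * (1 + y ^ 2)⁻¹ :=
    fun s hs y => (norm_mul_mul_le_of_le (hgC s y) (hlip s hs y) (hhC t y)).trans_eq (by ring)
  have hFi : ∀ s ∈ Metric.ball t ε, Integrable (F s) := fun s hs =>
    integrable_of_norm_le_inv_one_add_sq (hFc s) (hFle s hs)
  have hE : ∀ s ∈ Metric.ball t ε, ∀ x, ∫ y in Iic x, F s y = g s x * h t x - 1 :=
    fun s hs x => by
      refine integral_Iic_of_hasDerivAt_of_tendsto' (f := fun y => g s y * h t y)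
        (fun y _ => ?_) (hFi s hs).integrableOn ?_
      · refine ((hg s y).mul (hh t y)).congr_deriv ?_
        simp only [F]; noncomm_ring
      · simpa using (hg1 s).mul (hh1 t)
  have hball : ∀ᶠ s in 𝓝 t, s ∈ Metric.ball t ε := Metric.ball_mem_nhds t hε
  have hgt : ∀ y, Tendsto (fun s => g s y) (𝓝 t) (𝓝 (g t y)) := fun y => by
    have h1 : Tendsto (fun s => g s y * h t y - 1) (𝓝 t) (𝓝 0) := by
      have h2 : Tendsto (fun s => |s - t| * (C * C * C) * (Real.arctan y + Real.pi / 2)) (𝓝 t)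
          (𝓝 (|t - t| * (C * C * C) * (Real.arctan y + Real.pi / 2))) := by
        apply Continuous.tendsto (by fun_prop)
      rw [sub_self, abs_zero, zero_mul, zero_mul] at h2
      refine squeeze_zero_norm' ?_ h2
      filter_upwards [hball] with s hs
      rw [← hE s hs y]
      exact norm_integral_Iic_le (hFle s hs) y
    have h3 := (h1.add_const 1).mul_const (g t y)
    simpa [mul_assoc, hhg] using h3
  -- Zero curvature says exactly that g v g⁻¹ is the x-derivative of g Q g⁻¹, and Q → 0 removes the
  -- boundary term.
  have hlim : ∫ y in Iic x, g t y * v t y * h t y = g t x * Q x * h t x := by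
    have h1 := integral_Iic_of_hasDerivAt_of_tendsto' (a := x)
      (f := fun y => g t y * Q y * h t y) (f' := fun y => g t y * v t y * h t y) (m := 0)
      (fun y _ => by
        refine (((hg t y).mul (hQ y)).mul (hh t y)).congr_deriv ?_
        rw [Pi.mul_apply]
        noncomm_ring)
      ?_ ?_
    · rw [h1, sub_zero]
    · refine (integrable_of_norm_le_inv_one_add_sq (((hgc t).mul hvc).mul (hhc t))
        (C := C * C * C) fun y => ?_).integrableOn
      exact (norm_mul_mul_le_of_le (hgC t y) (hv t ht y) (hhC t y)).trans_eq (by ring)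
    · simpa using ((hg1 t).mul hQ0).mul (hh1 t)
  -- Divide the Duhamel formula by s - t and pass to the limit; the Lipschitz bound `hlip` supplies
  -- the dominating function.
  have hmain : HasDerivAt (fun s => g s x * h t x - 1) (g t x * Q x * h t x) t := by
    rw [hasDerivAt_iff_tendsto_slope, ← hlim]
    have hball' : ∀ᶠ s in 𝓝[≠] t, s ∈ Metric.ball t ε := nhdsWithin_le_nhds hball
    have h1 : Tendsto (fun s => ∫ y in Iic x, (s - t)⁻¹ • F s y) (𝓝[≠] t)
        (𝓝 (∫ y in Iic x, g t y * v t y * h t y)) := by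
      refine tendsto_integral_filter_of_dominated_convergence
        (fun y => C * C * C * (1 + y ^ 2)⁻¹) (.of_forall fun s =>
          ((hFc s).const_smul _).aestronglyMeasurable) ?_
        (integrable_inv_one_add_sq.const_mul _).integrableOn (.of_forall fun y => ?_)
      · filter_upwards [hball', self_mem_nhdsWithin] with s hs hst
        refine .of_forall fun y => ?_
        have hst' : 0 < |s - t| := abs_pos.2 (sub_ne_zero.2 hst)
        rw [norm_smul, norm_inv, Real.norm_eq_abs, inv_mul_le_iff₀ hst', ← mul_assoc]
        exact hFle s hs y
      · have h2 := (hasDerivAt_iff_tendsto_slope.1 (hu t ht y))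
        have h3 := (((hgt y).mono_left nhdsWithin_le_nhds).mul h2).mul_const (h t y)
        refine h3.congr fun s => ?_
        simp only [F, slope_def_module, mul_smul_comm, smul_mul_assoc]
    refine h1.congr' ?_
    filter_upwards [hball'] with s hs
    rw [integral_smul, hE s hs x, slope_def_module, hgh t x, sub_self, sub_zero]
  have h4 := (hmain.add_const 1).mul_const (g t x)
  simpa [mul_assoc, hhg] using h4

end TimeDerivative

/-! ### Joint smoothness in time and space -/

section JointSmoothness

variable {A : Type*} [NormedRing A] [NormedAlgebra ℝ A]

/-- Near a point g_x = g R is bounded, so the g(s, ·) are equi-Lipschitz in x; with continuity in t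
at fixed x this gives joint continuity. -/
theorem continuousOn_uncurry_of_hasDerivAt {J : Set ℝ} (hJ : IsOpen J) {g R : ℝ → ℝ → A} {C : ℝ}
    (hR : ContinuousOn (fun p : ℝ × ℝ => R p.1 p.2) (J ×ˢ univ))
    (hgC : ∀ t ∈ J, ∀ x, ‖g t x‖ ≤ C)
    (hx : ∀ t ∈ J, ∀ x, HasDerivAt (g t) (g t x * R t x) x)
    (ht : ∀ t ∈ J, ∀ x, ContinuousAt (fun s => g s x) t) :
    ContinuousOn (fun p : ℝ × ℝ => g p.1 p.2) (J ×ˢ univ) := by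
  rintro ⟨t, x⟩ ⟨htJ, -⟩
  have hJx : J ×ˢ univ ∈ 𝓝 (t, x) := (hJ.prod isOpen_univ).mem_nhds ⟨htJ, mem_univ x⟩
  refine ContinuousAt.continuousWithinAt ?_
  have hb : ∀ᶠ p in 𝓝 (t, x), p.1 ∈ J ∧ ‖R p.1 p.2‖ < ‖R t x‖ + 1 := by
    have h1 := (hR.continuousAt hJx).norm.eventually_lt_const (lt_add_one ‖R t x‖)
    filter_upwards [h1, hJx] with p hp hp' using ⟨hp'.1, hp⟩
  obtain ⟨δ, hδ, hb⟩ := Metric.eventually_nhds_iff_ball.1 hb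
  have hC0 : 0 ≤ C := (norm_nonneg _).trans (hgC t htJ x)
  have hball : ∀ s ∈ Metric.ball t δ, ∀ y ∈ Metric.ball x δ, (s, y) ∈ Metric.ball (t, x) δ :=
    fun s hs y hy => by rw [← ball_prod_same]; exact ⟨hs, hy⟩
  have hlip : ∀ s ∈ Metric.ball t δ, ∀ y ∈ Metric.ball x δ,
      ‖g s y - g s x‖ ≤ C * (‖R t x‖ + 1) * ‖y - x‖ := fun s hs y hy => by
    refine (convex_ball x δ).norm_image_sub_le_of_norm_hasDerivWithin_le
      (fun z hz => (hx s (hb _ (hball s hs z hz)).1 z).hasDerivWithinAt) (fun z hz => ?_)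
      (Metric.mem_ball_self hδ) hy
    exact (norm_mul_le _ _).trans (mul_le_mul (hgC s (hb _ (hball s hs z hz)).1 z)
      (hb _ (hball s hs z hz)).2.le (norm_nonneg _) hC0)
  have h1 : Tendsto (fun p : ℝ × ℝ => g p.1 x) (𝓝 (t, x)) (𝓝 (g t x)) :=
    (ht t htJ x).tendsto.comp continuous_fst.continuousAt
  have h2 : Tendsto (fun p : ℝ × ℝ => g p.1 p.2 - g p.1 x) (𝓝 (t, x)) (𝓝 0) := by
    have h3 : Tendsto (fun p : ℝ × ℝ => C * (‖R t x‖ + 1) * ‖p.2 - x‖) (𝓝 (t, x))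
        (𝓝 (C * (‖R t x‖ + 1) * ‖x - x‖)) := by
      apply Continuous.tendsto' (by fun_prop); rfl
    rw [sub_self, norm_zero, mul_zero] at h3
    refine squeeze_zero_norm' ?_ h3
    filter_upwards [Metric.ball_mem_nhds (t, x) hδ] with p hp
    rw [← ball_prod_same] at hp
    exact hlip p.1 hp.1 p.2 hp.2
  have h4 := h2.add h1
  simpa [ContinuousAt] using h4

/-- A bounded solution of the linear system `g_t = g P`, `g_x = g R` with smooth coefficients is
smooth in `(t, x)`. -/
theorem contDiffOn_of_hasDerivAt_mul {J : Set ℝ} (hJ : IsOpen J) {g P R : ℝ → ℝ → A} {C : ℝ}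
    (hP : ContDiffOn ℝ ∞ (fun p : ℝ × ℝ => P p.1 p.2) (J ×ˢ univ))
    (hR : ContDiffOn ℝ ∞ (fun p : ℝ × ℝ => R p.1 p.2) (J ×ˢ univ))
    (hgC : ∀ t ∈ J, ∀ x, ‖g t x‖ ≤ C)
    (ht : ∀ t ∈ J, ∀ x, HasDerivAt (fun s => g s x) (g t x * P t x) t)
    (hx : ∀ t ∈ J, ∀ x, HasDerivAt (g t) (g t x * R t x) x) :
    ContDiffOn ℝ ∞ (fun p : ℝ × ℝ => g p.1 p.2) (J ×ˢ univ) := by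
  have hO : IsOpen (J ×ˢ (univ : Set ℝ)) := hJ.prod isOpen_univ
  have hc := continuousOn_uncurry_of_hasDerivAt hJ hR.continuousOn hgC hx
    fun t htJ x => (ht t htJ x).continuousAt
  let T : A →L[ℝ] ℝ →L[ℝ] A := ContinuousLinearMap.smulRightL ℝ ℝ A 1
  let D : ℝ × ℝ → (ℝ × ℝ →L[ℝ] A) := fun p =>
    (T (g p.1 p.2 * P p.1 p.2)).comp (ContinuousLinearMap.fst ℝ ℝ ℝ) +
      (T (g p.1 p.2 * R p.1 p.2)).comp (ContinuousLinearMap.snd ℝ ℝ ℝ)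
  have hD : ∀ p ∈ J ×ˢ (univ : Set ℝ), HasFDerivAt (fun p : ℝ × ℝ => g p.1 p.2) (D p) p := by
    rintro ⟨t, x⟩ htx
    have hJx := hO.mem_nhds htx
    have h1 := hasStrictFDerivAt_uncurry_coprod (𝕜 := ℝ) (u := (t, x)) (f := g)
      (f₁ := fun t x => T (g t x * P t x)) (f₂ := fun t x => T (g t x * R t x))
      (by filter_upwards [hJx] with p hp using (ht p.1 hp.1 p.2).hasFDerivAt)
      (by filter_upwards [hJx] with p hp using (hx p.1 hp.1 p.2).hasFDerivAt)
      (T.continuous.continuousAt.comp ((hc.mul hP.continuousOn).continuousAt hJx))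
      (T.continuous.continuousAt.comp ((hc.mul hR.continuousOn).continuousAt hJx))
    refine h1.hasFDerivAt.congr_fderiv ?_
    ext <;> simp [D, Function.HasUncurry.uncurry]
  -- Bootstrap: the total derivative D is g times smooth coefficients, so g of class C^n makes D of
  -- class C^n and g of class C^(n+1).
  have key : ∀ n : ℕ, ContDiffOn ℝ n (fun p : ℝ × ℝ => g p.1 p.2) (J ×ˢ univ) := by
    intro n
    induction n with
    | zero => simpa using hc
    | succ n ih =>
      have hn : ((n : ℕ∞) : WithTop ℕ∞) ≤ ∞ := by exact_mod_cast le_top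
      push_cast
      rw [contDiffOn_succ_iff_fderiv_of_isOpen hO]
      refine ⟨fun p hp => (hD p hp).differentiableAt.differentiableWithinAt, by simp, ?_⟩
      have hDn : ContDiffOn ℝ n D (J ×ˢ univ) :=
        (((T.contDiff.comp_contDiffOn (ih.mul (hP.of_le hn))).clm_comp contDiffOn_const).add
          ((T.contDiff.comp_contDiffOn (ih.mul (hR.of_le hn))).clm_comp contDiffOn_const))
      exact hDn.congr fun p hp => (hD p hp).fderiv
  exact contDiffOn_infty.2 key

variable {J : Set ℝ} {F : ℝ → ℝ → A}

theorem hasDerivAt_snd_of_contDiffOn (hJ : IsOpen J)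
    (hF : ContDiffOn ℝ ∞ (fun p : ℝ × ℝ => F p.1 p.2) (J ×ˢ univ)) {t : ℝ} (ht : t ∈ J) (x : ℝ) :
    HasDerivAt (F t) (fderiv ℝ (fun p : ℝ × ℝ => F p.1 p.2) (t, x) (0, 1)) x := by
  have h := ((hF.contDiffAt ((hJ.prod isOpen_univ).mem_nhds
    (⟨ht, mem_univ x⟩ : (t, x) ∈ J ×ˢ univ))).differentiableAt (by simp)).hasFDerivAt
  exact h.comp_hasDerivAt x ((hasDerivAt_const x t).prodMk (hasDerivAt_id x))

theorem hasDerivAt_fst_of_contDiffOn (hJ : IsOpen J)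
    (hF : ContDiffOn ℝ ∞ (fun p : ℝ × ℝ => F p.1 p.2) (J ×ˢ univ)) {t : ℝ} (ht : t ∈ J) (x : ℝ) :
    HasDerivAt (fun s => F s x) (fderiv ℝ (fun p : ℝ × ℝ => F p.1 p.2) (t, x) (1, 0)) t := by
  have h := ((hF.contDiffAt ((hJ.prod isOpen_univ).mem_nhds
    (⟨ht, mem_univ x⟩ : (t, x) ∈ J ×ˢ univ))).differentiableAt (by simp)).hasFDerivAt
  exact h.comp_hasDerivAt t ((hasDerivAt_id t).prodMk (hasDerivAt_const t x))

theorem contDiffOn_deriv_snd (hJ : IsOpen J)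
    (hF : ContDiffOn ℝ ∞ (fun p : ℝ × ℝ => F p.1 p.2) (J ×ˢ univ)) :
    ContDiffOn ℝ ∞ (fun p : ℝ × ℝ => deriv (F p.1) p.2) (J ×ˢ univ) := by
  have h := (hF.fderiv_of_isOpen (m := ∞) (hJ.prod isOpen_univ) (by simp)).clm_apply
    (contDiffOn_const (c := ((0, 1) : ℝ × ℝ)))
  exact h.congr fun p hp => (hasDerivAt_snd_of_contDiffOn hJ hF hp.1 p.2).deriv

/-- Equality of mixed partial derivatives. -/
theorem hasDerivAt_deriv_comm (hJ : IsOpen J)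
    (hF : ContDiffOn ℝ ∞ (fun p : ℝ × ℝ => F p.1 p.2) (J ×ˢ univ)) {V : ℝ → ℝ → A}
    (hV : ∀ t ∈ J, ∀ x, HasDerivAt (fun s => F s x) (V t x) t) {t : ℝ} (ht : t ∈ J) (x : ℝ) :
    HasDerivAt (fun s => deriv (F s) x) (deriv (V t) x) t := by
  let G : ℝ × ℝ → A := fun p => F p.1 p.2
  have hO : IsOpen (J ×ˢ (univ : Set ℝ)) := hJ.prod isOpen_univ
  have hJx : J ×ˢ univ ∈ 𝓝 (t, x) := hO.mem_nhds ⟨ht, mem_univ x⟩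
  have h2 : HasFDerivAt (fderiv ℝ G) (fderiv ℝ (fderiv ℝ G) (t, x)) (t, x) :=
    (((hF.fderiv_of_isOpen (m := ∞) hO (by simp)).contDiffAt hJx).differentiableAt
      (by simp)).hasFDerivAt
  have hsymm := (hF.contDiffAt hJx).isSymmSndFDerivAt
    (by
      rw [minSmoothness_of_isRCLikeNormedField]
      exact WithTop.coe_le_coe.2 (le_top : (2 : ℕ∞) ≤ ⊤))
  have hap : ∀ w : ℝ × ℝ, HasFDerivAt (fun p => fderiv ℝ G p w)
      ((ContinuousLinearMap.apply ℝ A w).comp (fderiv ℝ (fderiv ℝ G) (t, x))) (t, x) := fun w =>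
    (ContinuousLinearMap.apply ℝ A w).hasFDerivAt.comp (t, x) h2
  have ha : HasDerivAt (fun s => fderiv ℝ G (s, x) (0, 1))
      (fderiv ℝ (fderiv ℝ G) (t, x) (1, 0) (0, 1)) t := by
    have h := (hap (0, 1)).comp_hasDerivAt t ((hasDerivAt_id t).prodMk (hasDerivAt_const t x))
    exact h
  have hb : HasDerivAt (fun y => fderiv ℝ G (t, y) (1, 0))
      (fderiv ℝ (fderiv ℝ G) (t, x) (0, 1) (1, 0)) x := by
    have h := (hap (1, 0)).comp_hasDerivAt x ((hasDerivAt_const x t).prodMk (hasDerivAt_id x))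
    exact h
  have hVt : V t = fun y => fderiv ℝ G (t, y) (1, 0) := funext fun y =>
    (hV t ht y).unique (hasDerivAt_fst_of_contDiffOn hJ hF ht y)
  rw [hVt, hb.deriv, hsymm.eq]
  refine ha.congr_of_eventuallyEq ?_
  filter_upwards [hJ.mem_nhds ht] with s hs using (hasDerivAt_snd_of_contDiffOn hJ hF hs x).deriv

end JointSmoothness

/-! ### Bounded families of Schwartz functions -/

section SchwartzFamilies

variable {A : Type*} [NormedRing A] [NormedAlgebra ℝ A] {ι : Type*}

/-- The derivatives of order at most `l` of the smooth functions `f i` are bounded by a multiple of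
`|x| ^ (-p)`, uniformly in `i`. -/
def UniformDecay (p l : ℕ) (f : ι → ℝ → A) : Prop :=
  (∀ i, ContDiff ℝ ∞ (f i)) ∧
    ∀ j ≤ l, ∃ C : ℝ, ∀ i x, |x| ^ p * ‖iteratedDeriv j (f i) x‖ ≤ C

/-- A family of Schwartz functions that is bounded in the Schwartz topology. -/
def UniformSchwartz (f : ι → ℝ → A) : Prop := ∀ p l, UniformDecay p l f

/-- A family of smooth functions with uniformly bounded derivatives. -/
def UniformSmooth (f : ι → ℝ → A) : Prop := ∀ l, UniformDecay 0 l f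

theorem contDiff_deriv {f : ℝ → A} (hf : ContDiff ℝ ∞ f) : ContDiff ℝ ∞ (deriv f) :=
  (contDiff_infty_iff_deriv.1 hf).2

theorem ContDiff.hasDerivAt_infty {f : ℝ → A} (hf : ContDiff ℝ ∞ f) (x : ℝ) :
    HasDerivAt f (deriv f x) x :=
  (hf.differentiable (by simp) x).hasDerivAt

theorem contDiff_infty_of_hasDerivAt_mul {g u : ℝ → A} (hu : ContDiff ℝ ∞ u)
    (hg : ∀ x, HasDerivAt g (g x * u x) x) : ContDiff ℝ ∞ g := by
  refine contDiff_infty.2 fun n => ?_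
  induction n with
  | zero => exact contDiff_zero.2 (continuous_iff_continuousAt.2 fun x => (hg x).continuousAt)
  | succ n ih =>
    push_cast
    refine contDiff_succ_iff_deriv.2 ⟨fun x => (hg x).differentiableAt, by simp, ?_⟩
    rw [show deriv g = fun x => g x * u x from funext fun x => (hg x).deriv]
    exact ih.mul (hu.of_le (by exact_mod_cast le_top))

theorem UniformDecay.mono {p l l' : ℕ} {f : ι → ℝ → A} (hf : UniformDecay p l f) (h : l' ≤ l) :
    UniformDecay p l' f :=
  ⟨hf.1, fun j hj => hf.2 j (hj.trans h)⟩

theorem uniformDecay_zero_iff {p : ℕ} {f : ι → ℝ → A} :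
    UniformDecay p 0 f ↔ (∀ i, ContDiff ℝ ∞ (f i)) ∧ ∃ C : ℝ, ∀ i x, |x| ^ p * ‖f i x‖ ≤ C := by
  refine and_congr_right fun _ => ⟨fun h => by simpa using h 0 le_rfl, fun h j hj => ?_⟩
  obtain rfl := Nat.le_zero.1 hj
  simpa using h

theorem uniformDecay_succ_iff {p l : ℕ} {f : ι → ℝ → A} :
    UniformDecay p (l + 1) f ↔
      UniformDecay p 0 f ∧ UniformDecay p l (fun i => deriv (f i)) := by
  constructor
  · intro h
    refine ⟨h.mono (Nat.zero_le _), fun i => contDiff_deriv (h.1 i), fun j hj => ?_⟩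
    simpa only [iteratedDeriv_succ'] using h.2 (j + 1) (Nat.succ_le_succ hj)
  · rintro ⟨h0, h⟩
    refine ⟨h0.1, fun j hj => ?_⟩
    cases j with
    | zero => exact h0.2 0 le_rfl
    | succ j => simpa only [iteratedDeriv_succ'] using h.2 j (Nat.succ_le_succ_iff.1 hj)

theorem UniformDecay.add {p l : ℕ} {f g : ι → ℝ → A} (hf : UniformDecay p l f)
    (hg : UniformDecay p l g) : UniformDecay p l (fun i x => f i x + g i x) := by
  refine ⟨fun i => (hf.1 i).add (hg.1 i), fun j hj => ?_⟩
  obtain ⟨C, hC⟩ := hf.2 j hj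
  obtain ⟨D, hD⟩ := hg.2 j hj
  refine ⟨C + D, fun i x => ?_⟩
  have hj' : (j : WithTop ℕ∞) ≤ ∞ := by exact_mod_cast le_top
  rw [iteratedDeriv_fun_add ((hf.1 i).of_le hj').contDiffAt ((hg.1 i).of_le hj').contDiffAt]
  refine (mul_le_mul_of_nonneg_left (norm_add_le _ _) (by positivity)).trans ?_
  rw [mul_add]
  exact add_le_add (hC i x) (hD i x)

/-- Leibniz rule by induction on l. The weights add, so a factor with p = 0, merely bounded with its
derivatives, preserves Schwartz decay. -/
theorem UniformDecay.mul {p q l : ℕ} {f g : ι → ℝ → A} (hf : UniformDecay p l f)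
    (hg : UniformDecay q l g) : UniformDecay (p + q) l (fun i x => f i x * g i x) := by
  induction l generalizing f g with
  | zero =>
    rw [uniformDecay_zero_iff] at hf hg ⊢
    obtain ⟨hfs, C, hC⟩ := hf
    obtain ⟨hgs, D, hD⟩ := hg
    refine ⟨fun i => (hfs i).mul (hgs i), C * D, fun i x => ?_⟩
    calc |x| ^ (p + q) * ‖f i x * g i x‖ ≤ |x| ^ (p + q) * (‖f i x‖ * ‖g i x‖) :=
          mul_le_mul_of_nonneg_left (norm_mul_le _ _) (by positivity)
      _ = (|x| ^ p * ‖f i x‖) * (|x| ^ q * ‖g i x‖) := by ring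
      _ ≤ C * D := mul_le_mul (hC i x) (hD i x) (by positivity)
          ((by positivity : 0 ≤ |x| ^ p * ‖f i x‖).trans (hC i x))
  | succ l ih =>
    have hf' := uniformDecay_succ_iff.1 hf
    have hg' := uniformDecay_succ_iff.1 hg
    refine uniformDecay_succ_iff.2 ⟨?_, ?_⟩
    · have h := ih (hf.mono l.le_succ) (hg.mono l.le_succ)
      exact h.mono (Nat.zero_le _)
    · have h := (ih hf'.2 (hg.mono l.le_succ)).add (ih (hf.mono l.le_succ) hg'.2)
      convert h using 2 with i
      funext x
      exact (((hf.1 i).hasDerivAt_infty x).mul ((hg.1 i).hasDerivAt_infty x)).deriv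

theorem UniformDecay.star [StarRing A] [NormedStarGroup A] [StarModule ℝ A] {p l : ℕ}
    {f : ι → ℝ → A} (hf : UniformDecay p l f) : UniformDecay p l (fun i x => star (f i x)) := by
  have hs : ∀ i, ContDiff ℝ ∞ (fun x => Star.star (f i x)) := fun i =>
    (starL' ℝ : A ≃L[ℝ] A).contDiff.comp (hf.1 i)
  induction l generalizing f with
  | zero =>
    rw [uniformDecay_zero_iff] at hf ⊢
    exact ⟨hs, by simpa only [norm_star] using hf.2⟩
  | succ l ih =>
    have hd : ∀ i, deriv (fun x => Star.star (f i x)) = fun x => Star.star (deriv (f i) x) :=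
      fun i => funext fun x => ((hf.1 i).hasDerivAt_infty x).star.deriv
    have hf' := uniformDecay_succ_iff.1 hf
    refine uniformDecay_succ_iff.2 ⟨(ih (hf.mono l.le_succ) hs).mono (Nat.zero_le _), ?_⟩
    simp only [hd]
    exact ih hf'.2 fun i => (starL' ℝ : A ≃L[ℝ] A).contDiff.comp (hf'.2.1 i)

theorem uniformSmooth_const (c : A) : UniformSmooth (fun (_ : ι) (_ : ℝ) => c) := by
  refine fun l => ⟨fun _ => contDiff_const, fun j _ => ⟨‖c‖, fun i x => ?_⟩⟩
  rw [iteratedDeriv_const]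
  split_ifs <;> simp

theorem UniformSchwartz.smooth {f : ι → ℝ → A} (hf : UniformSchwartz f) : UniformSmooth f :=
  hf 0

theorem UniformSchwartz.deriv {f : ι → ℝ → A} (hf : UniformSchwartz f) :
    UniformSchwartz (fun i => deriv (f i)) :=
  fun p l => (uniformDecay_succ_iff.1 (hf p (l + 1))).2

theorem UniformSchwartz.add {f g : ι → ℝ → A} (hf : UniformSchwartz f) (hg : UniformSchwartz g) :
    UniformSchwartz (fun i x => f i x + g i x) :=
  fun p l => (hf p l).add (hg p l)

theorem UniformSmooth.mul_schwartz {f g : ι → ℝ → A} (hf : UniformSmooth f)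
    (hg : UniformSchwartz g) : UniformSchwartz (fun i x => f i x * g i x) :=
  fun p l => by simpa only [zero_add] using (hf l).mul (hg p l)

theorem UniformSchwartz.mul_smooth {f g : ι → ℝ → A} (hf : UniformSchwartz f)
    (hg : UniformSmooth g) : UniformSchwartz (fun i x => f i x * g i x) :=
  fun p l => by simpa only [add_zero] using (hf p l).mul (hg l)

theorem UniformSchwartz.neg {f : ι → ℝ → A} (hf : UniformSchwartz f) :
    UniformSchwartz (fun i x => -f i x) := by
  simpa using (uniformSmooth_const (-1 : A)).mul_schwartz hf

theorem UniformSchwartz.sub {f g : ι → ℝ → A} (hf : UniformSchwartz f) (hg : UniformSchwartz g) :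
    UniformSchwartz (fun i x => f i x - g i x) := by
  simpa only [sub_eq_add_neg] using hf.add hg.neg

theorem UniformSmooth.star [StarRing A] [NormedStarGroup A] [StarModule ℝ A] {f : ι → ℝ → A}
    (hf : UniformSmooth f) : UniformSmooth (fun i x => star (f i x)) :=
  fun l => (hf l).star

theorem UniformSmooth.of_deriv_schwartz {f : ι → ℝ → A} (hf : ∀ i, ContDiff ℝ ∞ (f i)) {C : ℝ}
    (hC : ∀ i x, ‖f i x‖ ≤ C) (hd : UniformSchwartz (fun i => _root_.deriv (f i))) :
    UniformSmooth f := fun l =>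
  (uniformDecay_succ_iff.2 ⟨uniformDecay_zero_iff.2 ⟨hf, C, by simpa using hC⟩, hd 0 l⟩).mono
    l.le_succ

/-- Each derivative of g is traded for one fewer through g' = g u, so a sup bound on g alone starts
the induction. -/
theorem UniformSmooth.of_hasDerivAt_mul {g u : ι → ℝ → A} {C : ℝ} (hC : ∀ i x, ‖g i x‖ ≤ C)
    (hu : UniformSchwartz u) (hg : ∀ i x, HasDerivAt (g i) (g i x * u i x) x) :
    UniformSmooth g := by
  have hs : ∀ i, ContDiff ℝ ∞ (g i) := fun i =>
    contDiff_infty_of_hasDerivAt_mul ((hu 0 0).1 i) (hg i)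
  have h0 : UniformDecay 0 0 g := uniformDecay_zero_iff.2 ⟨hs, C, by simpa using hC⟩
  intro l
  induction l with
  | zero => exact h0
  | succ l ih =>
    refine uniformDecay_succ_iff.2 ⟨h0, ?_⟩
    rw [show (fun i => _root_.deriv (g i)) = fun i x => g i x * u i x from
      funext fun i => funext fun x => (hg i x).deriv]
    simpa using ih.mul (hu 0 l)

/-- Adding the seminorms of weights 0 and 2 produces the integrable majorant required by the frame
equation. -/
theorem UniformSchwartz.norm_le {f : ι → ℝ → A} (hf : UniformSchwartz f) :
    ∃ C : ℝ, ∀ i x, ‖f i x‖ ≤ C * (1 + x ^ 2)⁻¹ := by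
  obtain ⟨C, hC⟩ := (hf 0 0).2 0 le_rfl
  obtain ⟨D, hD⟩ := (hf 2 0).2 0 le_rfl
  refine ⟨C + D, fun i x => ?_⟩
  have h1 := hC i x
  have h2 := hD i x
  rw [iteratedDeriv_zero] at h1 h2
  rw [sq_abs] at h2
  rw [← div_eq_mul_inv, le_div_iff₀ (by positivity)]
  linarith

theorem UniformSchwartz.tendsto_atBot {f : ι → ℝ → A} (hf : UniformSchwartz f) (i : ι) :
    Tendsto (f i) atBot (𝓝 0) := by
  obtain ⟨C, hC⟩ := hf.norm_le
  refine squeeze_zero_norm (hC i) ?_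
  have h : Tendsto (fun x : ℝ => 1 + x ^ 2) atBot atTop :=
    by
    refine tendsto_atTop_add_const_left _ _ ?_
    simpa only [Function.comp_def, sq_abs] using
      (tendsto_pow_atTop (α := ℝ) two_ne_zero).comp tendsto_abs_atBot_atTop
  simpa using h.inv_tendsto_atTop.const_mul C

/-- The Schwartz function underlying a uniformly Schwartz family with one member. -/
noncomputable def UniformSchwartz.toSchwartzMap {f : ι → ℝ → A} (hf : UniformSchwartz f) (i : ι) :
    𝓢(ℝ, A) where
  toFun := f i
  smooth' := (hf 0 0).1 i
  decay' p l := by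
    obtain ⟨C, hC⟩ := (hf p l).2 l le_rfl
    exact ⟨C, fun x => by
      simpa only [Real.norm_eq_abs, norm_iteratedFDeriv_eq_norm_iteratedDeriv] using hC i x⟩

theorem SchwartzMap.uniformSchwartz (f : 𝓢(ℝ, A)) : UniformSchwartz (fun _ : Unit => ⇑f) := by
  refine fun p l => ⟨fun _ => f.smooth', fun j _ => ?_⟩
  obtain ⟨C, hC⟩ := f.decay' p j
  refine ⟨C, fun _ x => ?_⟩
  have h := hC x
  rwa [Real.norm_eq_abs, norm_iteratedFDeriv_eq_norm_iteratedDeriv] at h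

end SchwartzFamilies

/-! ### Algebra of the relation c² = -1/4 -/

section Algebra

variable {A : Type*} [Ring A]

theorem mul_left_neg_of_anticomm {a u : A} (h : u * a = -(a * u)) (x : A) :
    u * (a * x) = -(a * (u * x)) := by
  rw [← mul_assoc, h, neg_mul, mul_assoc]

theorem conj_mul_conj {g h x y : A} (hg : h * g = 1) :
    (g * x * h) * (g * y * h) = g * (x * y) * h := by
  have : g * x * h * (g * y * h) = g * x * (h * g) * (y * h) := by simp only [mul_assoc]
  rw [this, hg, mul_one]; simp only [mul_assoc]

theorem commutator_anticomm {c p : A} (h1 : p * c = -(c * p)) :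
    (c * p - p * c) * c = -(c * (c * p - p * c)) := by
  simp only [mul_sub, sub_mul, mul_assoc, h1, mul_neg, neg_mul, neg_neg]
  abel

variable [Algebra ℝ A]

theorem mul_mul_cancel_quarter {a : A} (ha : a * a = (-(1 / 4) : ℝ) • 1) (x : A) :
    a * (a * x) = (-(1 / 4) : ℝ) • x := by
  rw [← mul_assoc, ha, smul_mul_assoc, one_mul]

/-- On elements anticommuting with c, ad c is left multiplication by 2c, which squares to 4c² = -1:
it is the complex structure of the tangent space. -/
theorem commutator_commutator_self {c p : A} (hc : c * c = (-(1 / 4) : ℝ) • 1)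
    (h1 : p * c = -(c * p)) : (c * p - p * c) * c - c * (c * p - p * c) = p := by
  have hc' := mul_mul_cancel_quarter hc
  simp only [mul_sub, sub_mul, mul_assoc, hc', h1, mul_neg, neg_mul]
  module

/-- The zero curvature identity for `[c, c_x]` and `6 c c_x ^ 2 - c_xx` along the flow
`c_t = [c, c_xx]` on `c ^ 2 = -1/4`. -/
theorem zeroCurvature_identity {c p r s : A} (hc : c * c = (-(1 / 4) : ℝ) • 1)
    (h1 : p * c = -(c * p)) (h2 : r * c = -(c * r) - (2 : ℝ) • (p * p))
    (h3 : s * c = -(c * s) - (3 : ℝ) • (p * r + r * p)) :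
    ((c * r - r * c) * p + c * ((p * r + c * s) - (s * c + r * p))) -
      (((p * r + c * s) - (s * c + r * p)) * c + p * (c * r - r * c)) =
    ((6 : ℝ) • (p * (p * p) + c * (r * p + p * r)) - s) +
      (((6 : ℝ) • (c * (p * p)) - r) * (c * p - p * c) -
        (c * p - p * c) * ((6 : ℝ) • (c * (p * p)) - r)) := by
  have hc' := mul_mul_cancel_quarter hc
  have h1' := mul_left_neg_of_anticomm h1
  have h2' : ∀ x, r * (c * x) = -(c * (r * x)) - (2 : ℝ) • (p * (p * x)) := fun x => by
    rw [← mul_assoc, h2, sub_mul, neg_mul, smul_mul_assoc, mul_assoc, mul_assoc]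
  -- Every c is pushed to the left and c² is eliminated, leaving linear combinations of words in p,
  -- r, s with at most one leading c.
  simp only [mul_sub, sub_mul, mul_add, add_mul, mul_assoc, smul_mul_assoc, mul_smul_comm, h1,
    h1', h2, h2', h3, hc', mul_neg, neg_mul, smul_neg, smul_add, smul_sub]
  module

variable {a u v : A}

theorem commutator_base (hu : u * a = -(a * u)) : u * a - a * u = (-2 : ℝ) • (a * u) := by
  rw [hu]; module

/-- Here u² commutes with a, so a u² drops out of the commutator, and 2av contributes -4a²v = v. -/
theorem commutator_lax_base (ha : a * a = (-(1 / 4) : ℝ) • 1) (hu : u * a = -(a * u))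
    (hv : v * a = -(a * v)) :
    (2 : ℝ) • (a * (v + u * u)) * a - a * ((2 : ℝ) • (a * (v + u * u))) = v := by
  have ha' := mul_mul_cancel_quarter ha
  have hu' := mul_left_neg_of_anticomm hu
  simp only [mul_add, add_mul, mul_assoc, smul_mul_assoc, mul_smul_comm, hu, hu', hv, ha',
    mul_neg, smul_add]
  module

/-- With v = u_x, the frame expression of γ_xx is -2av + 4au². The second term commutes with a, so
[γ, γ_xx] becomes u_x. -/
theorem commutator_second_deriv_base (ha : a * a = (-(1 / 4) : ℝ) • 1) (hu : u * a = -(a * u))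
    (hv : v * a = -(a * v)) :
    a * ((-2 : ℝ) • (a * v) + u * ((-2 : ℝ) • (a * u)) - (-2 : ℝ) • (a * u) * u) -
      ((-2 : ℝ) • (a * v) + u * ((-2 : ℝ) • (a * u)) - (-2 : ℝ) • (a * u) * u) * a = v := by
  have ha' := mul_mul_cancel_quarter ha
  have hu' := mul_left_neg_of_anticomm hu
  simp only [mul_add, add_mul, mul_sub, sub_mul, mul_assoc, smul_mul_assoc, mul_smul_comm, hu,
    hu', hv, ha', mul_neg, neg_mul, smul_neg]
  module

/-- In the frame γ_x² becomes u² and γ_xx becomes -2av + 4au²; the coefficient 6 is the one leaving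
2au². -/
theorem generator_base (ha : a * a = (-(1 / 4) : ℝ) • 1) (hu : u * a = -(a * u)) :
    (6 : ℝ) • (a * ((-2 : ℝ) • (a * u) * ((-2 : ℝ) • (a * u)))) -
      ((-2 : ℝ) • (a * v) + u * ((-2 : ℝ) • (a * u)) - (-2 : ℝ) • (a * u) * u) =
    (2 : ℝ) • (a * (v + u * u)) := by
  have ha' := mul_mul_cancel_quarter ha
  have hu' := mul_left_neg_of_anticomm hu
  simp only [mul_add, mul_assoc, smul_mul_assoc, mul_smul_comm,
    hu', ha', mul_neg, smul_add]
  module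

theorem commutator_conj_base (ha : a * a = (-(1 / 4) : ℝ) • 1) (hu : u * a = -(a * u)) :
    a * ((-2 : ℝ) • (a * u)) - (-2 : ℝ) • (a * u) * a = u := by
  have ha' := mul_mul_cancel_quarter ha
  simp only [mul_assoc, smul_mul_assoc, mul_smul_comm, hu, ha', mul_neg]
  module

end Algebra

/-! ### Unitary frames of a skew connection -/

section Frames

variable {A : Type*} [NormedRing A] [NormedAlgebra ℝ A]

theorem eq_of_hasDerivAt_zero_of_tendsto {f : ℝ → A} {c : A} (hf : ∀ x, HasDerivAt f 0 x)
    (hl : Tendsto f atBot (𝓝 c)) (x : ℝ) : f x = c := by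
  have hconst : f = fun _ => f x := funext fun y =>
    is_const_of_deriv_eq_zero (fun z => (hf z).differentiableAt) (fun z => (hf z).deriv) y x
  rw [hconst] at hl
  exact tendsto_nhds_unique tendsto_const_nhds hl

/-- Derivative of a conjugate `g f g⁻¹` where `g' = g u`. -/
theorem hasDerivAt_conj {g h f : ℝ → A} {w f' : A} {x : ℝ} (hg : HasDerivAt g (g x * w) x)
    (hh : HasDerivAt h (-(w * h x)) x) (hf : HasDerivAt f f' x) :
    HasDerivAt (fun x => g x * f x * h x) (g x * (f' + w * f x - f x * w) * h x) x := by
  refine ((hg.mul hf).mul hh).congr_deriv ?_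
  rw [Pi.mul_apply]
  noncomm_ring

variable [StarRing A]

/-- `g` is the unitary parallel frame of the connection `u`, normalized at `-∞`. -/
structure IsFrame (u g : ℝ → A) : Prop where
  hasDerivAt : ∀ x, HasDerivAt g (g x * u x) x
  star_mul : ∀ x, star (g x) * g x = 1
  mul_star : ∀ x, g x * star (g x) = 1
  tendsto : Tendsto g atBot (𝓝 1)

variable {u g h : ℝ → A}

theorem IsFrame.contDiff (hg : IsFrame u g) (hu : ContDiff ℝ ∞ u) : ContDiff ℝ ∞ g :=
  contDiff_infty_of_hasDerivAt_mul hu hg.hasDerivAt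

theorem IsFrame.mem_unitary (hg : IsFrame u g) (x : ℝ) : g x ∈ unitary A :=
  Unitary.mem_iff.2 ⟨hg.star_mul x, hg.mul_star x⟩

variable [NormedStarGroup A]

theorem IsFrame.tendsto_star (hg : IsFrame u g) :
    Tendsto (fun x => star (g x)) atBot (𝓝 1) := by
  simpa using hg.tendsto.star

variable [StarModule ℝ A]

theorem hasDerivAt_star_of_skew {x : ℝ} {w : A} (hu : star w = -w)
    (hg : HasDerivAt g (g x * w) x) : HasDerivAt (fun x => star (g x)) (-(w * star (g x))) x := by
  refine hg.star.congr_deriv ?_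
  rw [StarMul.star_mul, hu, neg_mul]

namespace IsFrame

theorem hasDerivAt_star (hg : IsFrame u g) (hu : ∀ x, star (u x) = -u x) (x : ℝ) :
    HasDerivAt (fun x => star (g x)) (-(u x * star (g x))) x :=
  hasDerivAt_star_of_skew (hu x) (hg.hasDerivAt x)

/-- The product g h* has zero derivative and tends to 1 at -∞. -/
theorem unique (hg : IsFrame u g) (hh : IsFrame u h) (hu : ∀ x, star (u x) = -u x) : g = h := by
  have h1 : ∀ x, g x * star (h x) = 1 := eq_of_hasDerivAt_zero_of_tendsto
    (fun x => ((hg.hasDerivAt x).mul (hh.hasDerivAt_star hu x)).congr_deriv (by noncomm_ring))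
    (by simpa using hg.tendsto.mul hh.tendsto_star)
  funext x
  rw [← mul_one (g x), ← hh.star_mul x, ← mul_assoc, h1, one_mul]

/-- Skewness of u makes g g* constant, hence 1; Dedekind finiteness turns this one-sided inverse
into a two-sided one. -/
theorem exists_of_norm_le [CompleteSpace A] [IsDedekindFiniteMonoid A] (hu : Continuous u)
    (hs : ∀ x, star (u x) = -u x) {C : ℝ} (hC : ∀ x, ‖u x‖ ≤ C * (1 + x ^ 2)⁻¹) :
    ∃ g, IsFrame u g := by
  obtain ⟨g, hg, hl⟩ := exists_linearODE_solution_atBot hu hC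
  have h1 : ∀ x, g x * star (g x) = 1 := eq_of_hasDerivAt_zero_of_tendsto
    (fun x => ((hg x).mul (hasDerivAt_star_of_skew (hs x) (hg x))).congr_deriv (by noncomm_ring))
    (by simpa using hl.mul hl.star)
  exact ⟨g, hg, fun x => mul_eq_one_symm (h1 x), h1, hl⟩

theorem hasDerivAt_conj (hg : IsFrame u g) (hu : ∀ x, star (u x) = -u x) {f : ℝ → A} {f' : A}
    {x : ℝ} (hf : HasDerivAt f f' x) :
    HasDerivAt (fun x => g x * f x * star (g x))
      (g x * (f' + u x * f x - f x * u x) * star (g x)) x :=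
  _root_.hasDerivAt_conj (hg.hasDerivAt x) (hg.hasDerivAt_star hu x) hf

/-- The adjoint frame is the frame of the connection transported to the ambient trivialization. -/
theorem adjoint (hg : IsFrame u g) (hu : ∀ x, star (u x) = -u x) :
    IsFrame (fun x => -(g x * u x * star (g x))) (fun x => star (g x)) where
  hasDerivAt x := by
    refine (hg.hasDerivAt_star hu x).congr_deriv ?_
    rw [mul_neg, ← mul_assoc, ← mul_assoc, hg.star_mul, one_mul]
  star_mul x := by simpa using hg.mul_star x
  mul_star x := by simpa using hg.star_mul x
  tendsto := hg.tendsto_star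

end IsFrame

end Frames

/-! ### The connection and generator, ambient and in the frame -/

section Connections

variable {A : Type*} [NormedRing A] [NormedAlgebra ℝ A]

/-- The connection `[γ, γ_x]` in the ambient trivialization. -/
noncomputable def ambientConnection (γ : ℝ → A) (x : ℝ) : A := γ x * deriv γ x - deriv γ x * γ x

/-- The time component `6 γ γ_x ^ 2 - γ_xx` of the zero curvature pair in the ambient
trivialization. -/
noncomputable def ambientGenerator (γ : ℝ → A) (x : ℝ) : A :=
  (6 : ℝ) • (γ x * (deriv γ x * deriv γ x)) - deriv (deriv γ) x

/-- The time component `2 a (u_x + u ^ 2)` of the zero curvature pair in the moving frame. -/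
noncomputable def frameGenerator (a : A) (u : ℝ → A) (x : ℝ) : A :=
  (2 : ℝ) • (a * (deriv u x + u x * u x))

variable {γ u : ℝ → A} {a : A}

section Square

variable (hγ : ContDiff ℝ ∞ γ) (hsq : ∀ x, γ x * γ x = (-(1 / 4) : ℝ) • 1)
include hγ hsq

/-- This and the next two relations are successive derivatives of γ² = -1/4; they are the hypotheses
of `zeroCurvature_identity`. -/
theorem deriv_mul_self_of_sq (x : ℝ) : deriv γ x * γ x = -(γ x * deriv γ x) := by
  have h := (hγ.hasDerivAt_infty x).mul (hγ.hasDerivAt_infty x)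
  have h' : HasDerivAt (γ * γ) 0 x := by
    rw [show γ * γ = fun _ => (-(1 / 4) : ℝ) • (1 : A) from funext hsq]
    exact hasDerivAt_const _ _
  exact eq_neg_of_add_eq_zero_left (h.unique h')

theorem deriv_two_mul_self_of_sq (x : ℝ) : deriv (deriv γ) x * γ x =
    -(γ x * deriv (deriv γ) x) - (2 : ℝ) • (deriv γ x * deriv γ x) := by
  have h0 := hγ.hasDerivAt_infty x
  have h1 := (contDiff_deriv hγ).hasDerivAt_infty x
  have h := (h1.mul h0)
  rw [show deriv γ * γ = -(γ * deriv γ) from funext (deriv_mul_self_of_sq hγ hsq)] at h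
  have h' := (h0.mul h1).neg
  rw [eq_sub_of_add_eq (h.unique h')]
  module

theorem deriv_three_mul_self_of_sq (x : ℝ) : deriv (deriv (deriv γ)) x * γ x =
    -(γ x * deriv (deriv (deriv γ)) x) -
      (3 : ℝ) • (deriv γ x * deriv (deriv γ) x + deriv (deriv γ) x * deriv γ x) := by
  have h0 := hγ.hasDerivAt_infty x
  have h1 := (contDiff_deriv hγ).hasDerivAt_infty x
  have h2 := (contDiff_deriv (contDiff_deriv hγ)).hasDerivAt_infty x
  have h := (h2.mul h0)
  rw [show deriv (deriv γ) * γ = -(γ * deriv (deriv γ)) - (2 : ℝ) • (deriv γ * deriv γ) from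
    funext (deriv_two_mul_self_of_sq hγ hsq)] at h
  have h' := (h0.mul h2).neg.sub ((h1.mul h1).const_smul (2 : ℝ))
  rw [eq_sub_of_add_eq (h.unique h')]
  module

theorem ambientConnection_mul_self (x : ℝ) :
    ambientConnection γ x * γ x = -(γ x * ambientConnection γ x) :=
  commutator_anticomm (deriv_mul_self_of_sq hγ hsq x)

/-- γ is parallel for the connection -[γ, γ_x], so conjugating γ by a frame of that connection gives
a constant. -/
theorem deriv_add_commutator_neg_ambientConnection (x : ℝ) :
    deriv γ x + -ambientConnection γ x * γ x - γ x * -ambientConnection γ x = 0 := by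
  have h : ambientConnection γ x * γ x - γ x * ambientConnection γ x = deriv γ x :=
    commutator_commutator_self (hsq x) (deriv_mul_self_of_sq hγ hsq x)
  rw [← h]
  noncomm_ring

end Square

theorem hasDerivAt_ambientGenerator (hγ : ContDiff ℝ ∞ γ) (x : ℝ) :
    HasDerivAt (ambientGenerator γ)
      ((6 : ℝ) • (deriv γ x * (deriv γ x * deriv γ x) +
        γ x * (deriv (deriv γ) x * deriv γ x + deriv γ x * deriv (deriv γ) x)) -
        deriv (deriv (deriv γ)) x) x := by
  have h0 := hγ.hasDerivAt_infty x
  have h1 := (contDiff_deriv hγ).hasDerivAt_infty x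
  have h2 := (contDiff_deriv (contDiff_deriv hγ)).hasDerivAt_infty x
  exact ((h0.mul (h1.mul h1)).const_smul (6 : ℝ)).sub h2

theorem ContDiff.ambientConnection (hγ : ContDiff ℝ ∞ γ) :
    ContDiff ℝ ∞ (ambientConnection γ) :=
  (hγ.mul (contDiff_deriv hγ)).sub ((contDiff_deriv hγ).mul hγ)

theorem ContDiff.ambientGenerator (hγ : ContDiff ℝ ∞ γ) : ContDiff ℝ ∞ (ambientGenerator γ) :=
  ((hγ.mul ((contDiff_deriv hγ).mul (contDiff_deriv hγ))).const_smul (6 : ℝ)).sub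
    (contDiff_deriv (contDiff_deriv hγ))

theorem ContDiff.frameGenerator (hu : ContDiff ℝ ∞ u) : ContDiff ℝ ∞ (frameGenerator a u) :=
  (contDiff_const.mul ((contDiff_deriv hu).add (hu.mul hu))).const_smul (2 : ℝ)

section Uniform

variable {ι : Type*} {f : ι → ℝ → A}

theorem UniformSchwartz.const_smul (hf : UniformSchwartz f) (c : ℝ) :
    UniformSchwartz (fun i x => c • f i x) := by
  simpa using (uniformSmooth_const (c • (1 : A))).mul_schwartz hf

theorem UniformSmooth.ambientConnection (hf : UniformSmooth f)
    (hd : UniformSchwartz (fun i => _root_.deriv (f i))) :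
    UniformSchwartz (fun i => ambientConnection (f i)) :=
  (hf.mul_schwartz hd).sub (hd.mul_smooth hf)

theorem UniformSmooth.ambientGenerator (hf : UniformSmooth f)
    (hd : UniformSchwartz (fun i => _root_.deriv (f i))) :
    UniformSchwartz (fun i => ambientGenerator (f i)) :=
  ((hf.mul_schwartz (hd.mul_smooth hd.smooth)).const_smul 6).sub hd.deriv

theorem UniformSchwartz.frameGenerator (hf : UniformSchwartz f) :
    UniformSchwartz (fun i => frameGenerator a (f i)) :=
  ((uniformSmooth_const a).mul_schwartz (hf.deriv.add (hf.mul_smooth hf.smooth))).const_smul 2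

end Uniform

variable [StarRing A] {g : ℝ → A}

/-- `u` takes skew values anticommuting with `a`. -/
structure IsOffDiagonal (a : A) (u : ℝ → A) : Prop where
  skew : ∀ x, star (u x) = -u x
  anticomm : ∀ x, u x * a = -(a * u x)
  smooth : ContDiff ℝ ∞ u

theorem IsOffDiagonal.deriv_anticomm (hu : IsOffDiagonal a u) (x : ℝ) :
    deriv u x * a = -(a * deriv u x) := by
  have h := (hu.smooth.hasDerivAt_infty x)
  have h1 := h.mul_const a
  rw [funext hu.anticomm] at h1
  exact h1.unique (h.const_mul a).neg

theorem star_deriv_of_skew [NormedStarGroup A] [StarModule ℝ A] (hγ : ContDiff ℝ ∞ γ)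
    (hs : ∀ x, star (γ x) = -γ x) (x : ℝ) : star (deriv γ x) = -deriv γ x := by
  have h := hγ.hasDerivAt_infty x
  have h1 := h.star
  rw [funext hs] at h1
  exact h1.unique h.neg

theorem star_ambientConnection_of_skew [NormedStarGroup A] [StarModule ℝ A]
    (hγ : ContDiff ℝ ∞ γ) (hs : ∀ x, star (γ x) = -γ x) (x : ℝ) :
    star (ambientConnection γ x) = -ambientConnection γ x := by
  rw [ambientConnection, star_sub, star_mul, star_mul, hs, star_deriv_of_skew hγ hs]
  noncomm_ring

theorem IsOffDiagonal.deriv_skew [NormedStarGroup A] [StarModule ℝ A] (hu : IsOffDiagonal a u)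
    (x : ℝ) : star (deriv u x) = -deriv u x :=
  star_deriv_of_skew hu.smooth hu.skew x

theorem IsOffDiagonal.star_frameGenerator [NormedStarGroup A] [StarModule ℝ A]
    (hu : IsOffDiagonal a u) (ha : star a = -a) (x : ℝ) :
    star (frameGenerator a u x) = -frameGenerator a u x := by
  have h1 := hu.anticomm x
  have h2 := mul_left_neg_of_anticomm h1
  have h3 := hu.deriv_anticomm x
  simp only [frameGenerator, star_smul, star_mul, star_add, hu.skew, hu.deriv_skew, ha, star_trivial,
    neg_mul, mul_neg, mul_add, mul_assoc, h1, h2, h3]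
  module

theorem IsFrame.sq_eq (hg : IsFrame u g) (hγ : ∀ x, γ x = g x * a * star (g x))
    (ha : a * a = (-(1 / 4) : ℝ) • 1) (x : ℝ) : γ x * γ x = (-(1 / 4) : ℝ) • 1 := by
  rw [hγ, conj_mul_conj (hg.star_mul x), ha, mul_smul_comm, smul_mul_assoc, mul_one, hg.mul_star]

variable [NormedStarGroup A] [StarModule ℝ A]

namespace IsFrame

variable (hg : IsFrame u g) (hu : IsOffDiagonal a u) (hγ : ∀ x, γ x = g x * a * star (g x))
include hg hu hγ

theorem deriv_eq (x : ℝ) : deriv γ x = g x * ((-2 : ℝ) • (a * u x)) * star (g x) := by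
  rw [funext hγ, (hg.hasDerivAt_conj hu.skew (hasDerivAt_const x a)).deriv, zero_add,
    commutator_base (hu.anticomm x)]

theorem deriv_deriv_eq (x : ℝ) : deriv (deriv γ) x = g x * ((-2 : ℝ) • (a * deriv u x) +
    u x * ((-2 : ℝ) • (a * u x)) - (-2 : ℝ) • (a * u x) * u x) * star (g x) := by
  rw [funext (hg.deriv_eq hu hγ)]
  exact (hg.hasDerivAt_conj hu.skew
    (((hu.smooth.hasDerivAt_infty x).const_mul a).const_smul (-2 : ℝ))).deriv

theorem ambientConnection_eq (ha : a * a = (-(1 / 4) : ℝ) • 1) (x : ℝ) :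
    ambientConnection γ x = g x * u x * star (g x) := by
  rw [ambientConnection, hg.deriv_eq hu hγ, hγ, conj_mul_conj (hg.star_mul x),
    conj_mul_conj (hg.star_mul x), ← sub_mul, ← mul_sub, commutator_conj_base ha (hu.anticomm x)]

theorem ambientGenerator_eq (ha : a * a = (-(1 / 4) : ℝ) • 1) (x : ℝ) :
    ambientGenerator γ x = g x * frameGenerator a u x * star (g x) := by
  rw [ambientGenerator, hg.deriv_deriv_eq hu hγ, hg.deriv_eq hu hγ, hγ,
    conj_mul_conj (hg.star_mul x), conj_mul_conj (hg.star_mul x), frameGenerator,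
    ← generator_base ha (hu.anticomm x), ← smul_mul_assoc, ← mul_smul_comm, ← sub_mul, ← mul_sub]

theorem commutator_deriv_deriv_eq (ha : a * a = (-(1 / 4) : ℝ) • 1) (x : ℝ) :
    γ x * deriv (deriv γ) x - deriv (deriv γ) x * γ x = g x * deriv u x * star (g x) := by
  rw [hg.deriv_deriv_eq hu hγ, hγ, conj_mul_conj (hg.star_mul x), conj_mul_conj (hg.star_mul x),
    ← sub_mul, ← mul_sub, commutator_second_deriv_base ha (hu.anticomm x) (hu.deriv_anticomm x)]

/-- The connection on the left involves γ only, so uniqueness of frames recovers g from γ. -/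
theorem star_ambient (ha : a * a = (-(1 / 4) : ℝ) • 1) :
    IsFrame (fun x => -ambientConnection γ x) (fun x => star (g x)) := by
  simp only [hg.ambientConnection_eq hu hγ ha]
  exact hg.adjoint hu.skew

theorem eq_conj_ambientConnection (ha : a * a = (-(1 / 4) : ℝ) • 1) (x : ℝ) :
    u x = star (g x) * ambientConnection γ x * g x := by
  rw [hg.ambientConnection_eq hu hγ ha]
  have h : star (g x) * (g x * u x * star (g x)) * g x =
    (star (g x) * g x) * u x * (star (g x) * g x) := by simp only [mul_assoc]
  rw [h, hg.star_mul, one_mul, mul_one]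

end IsFrame

end Connections

/-! ### Passing between the two flows -/

section Flows

variable {A : Type*} [NormedRing A] [NormedAlgebra ℝ A]

theorem ContDiffOn.uncurry_ambientConnection {J : Set ℝ} (hJ : IsOpen J) {γ : ℝ → ℝ → A}
    (hγ : ContDiffOn ℝ ∞ (fun p : ℝ × ℝ => γ p.1 p.2) (J ×ˢ univ)) :
    ContDiffOn ℝ ∞ (fun p : ℝ × ℝ => ambientConnection (γ p.1) p.2) (J ×ˢ univ) :=
  (hγ.mul (contDiffOn_deriv_snd hJ hγ)).sub ((contDiffOn_deriv_snd hJ hγ).mul hγ)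

theorem ContDiffOn.uncurry_ambientGenerator {J : Set ℝ} (hJ : IsOpen J) {γ : ℝ → ℝ → A}
    (hγ : ContDiffOn ℝ ∞ (fun p : ℝ × ℝ => γ p.1 p.2) (J ×ˢ univ)) :
    ContDiffOn ℝ ∞ (fun p : ℝ × ℝ => ambientGenerator (γ p.1) p.2) (J ×ˢ univ) := by
  have h1 := contDiffOn_deriv_snd hJ hγ
  exact ((hγ.mul (h1.mul h1)).const_smul (6 : ℝ)).sub
    (contDiffOn_deriv_snd (F := fun t => deriv (γ t)) hJ h1)

theorem ContDiffOn.uncurry_frameGenerator {J : Set ℝ} (hJ : IsOpen J) {u : ℝ → ℝ → A} {a : A}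
    (hu : ContDiffOn ℝ ∞ (fun p : ℝ × ℝ => u p.1 p.2) (J ×ˢ univ)) :
    ContDiffOn ℝ ∞ (fun p : ℝ × ℝ => frameGenerator a (u p.1) p.2) (J ×ˢ univ) :=
  (contDiffOn_const.mul ((contDiffOn_deriv_snd hJ hu).add (hu.mul hu))).const_smul (2 : ℝ)

/-- Along the flow `γ_t = [γ, γ_xx]` on `γ ^ 2 = -1/4`, the pair `[γ, γ_x]`,
`6 γ γ_x ^ 2 - γ_xx` has zero curvature. -/
theorem hasDerivAt_ambientConnection_flow {J : Set ℝ} (hJ : IsOpen J) {γ : ℝ → ℝ → A}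
    (hγ : ContDiffOn ℝ ∞ (fun p : ℝ × ℝ => γ p.1 p.2) (J ×ˢ univ))
    (hs : ∀ t, ContDiff ℝ ∞ (γ t)) (hsq : ∀ t x, γ t x * γ t x = (-(1 / 4) : ℝ) • 1)
    (hflow : ∀ t ∈ J, ∀ x, HasDerivAt (fun s => γ s x)
      (γ t x * deriv (deriv (γ t)) x - deriv (deriv (γ t)) x * γ t x) t) {t : ℝ} (ht : t ∈ J)
    (x : ℝ) :
    HasDerivAt (fun s => ambientConnection (γ s) x)
      (deriv (ambientGenerator (γ t)) x +
        (ambientGenerator (γ t) x * ambientConnection (γ t) x -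
          ambientConnection (γ t) x * ambientGenerator (γ t) x)) t := by
  have h0 := (hs t).hasDerivAt_infty x
  have h1 := (contDiff_deriv (hs t)).hasDerivAt_infty x
  have h2 := (contDiff_deriv (contDiff_deriv (hs t))).hasDerivAt_infty x
  have hp : HasDerivAt (fun s => deriv (γ s) x) _ t := hasDerivAt_deriv_comm hJ hγ hflow ht x
  have hd : HasDerivAt (fun y => γ t y * deriv (deriv (γ t)) y - deriv (deriv (γ t)) y * γ t y)
      _ x := (h0.mul h2).sub (h2.mul h0)
  rw [hd.deriv] at hp
  have hc := hflow t ht x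
  refine ((hc.mul hp).sub (hp.mul hc)).congr_deriv ?_
  rw [(hasDerivAt_ambientGenerator (hs t) x).deriv]
  exact zeroCurvature_identity (hsq t x) (deriv_mul_self_of_sq (hs t) (hsq t) x)
    (deriv_two_mul_self_of_sq (hs t) (hsq t) x) (deriv_three_mul_self_of_sq (hs t) (hsq t) x)

theorem uniformSchwartz_at {J : Set ℝ} {f : ℝ → ℝ → A}
    (hf : ∀ K ⊆ J, IsCompact K → UniformSchwartz (fun t : K => f t)) {t : ℝ} (ht : t ∈ J) :
    UniformSchwartz (fun _ : Unit => f t) := fun p l => by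
  have h := hf {t} (singleton_subset_iff.2 ht) isCompact_singleton p l
  refine ⟨fun _ => h.1 ⟨t, rfl⟩, fun j hj => ?_⟩
  obtain ⟨D, hD⟩ := h.2 j hj
  exact ⟨D, fun _ => hD ⟨t, rfl⟩⟩

variable [StarRing A] [NormedStarGroup A] [StarModule ℝ A] {J : Set ℝ} {a : A}
  {γ u g : ℝ → ℝ → A} {C : ℝ}

/-- Packaging of `hasDerivAt_of_zeroCurvature` for families of unitary frames. -/
theorem IsFrame.hasDerivAt_of_zeroCurvature [CompleteSpace A] (hJ : IsOpen J) {v : ℝ → ℝ → A}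
    {Q : ℝ → ℝ → A} (hC : ∀ U ∈ unitary A, ‖U‖ ≤ C) (hg : ∀ t, IsFrame (u t) (g t))
    (hskew : ∀ t x, star (u t x) = -u t x) (huc : ∀ t, Continuous (u t))
    (hu : ∀ t ∈ J, ∀ x, HasDerivAt (fun s => u s x) (v t x) t)
    (hv : ∀ K ⊆ J, IsCompact K → UniformSchwartz (fun t : K => v t))
    (hQ : ∀ t ∈ J, ∀ x, HasDerivAt (Q t) (v t x - (u t x * Q t x - Q t x * u t x)) x)
    (hQ0 : ∀ t ∈ J, Tendsto (Q t) atBot (𝓝 0)) {t : ℝ} (ht : t ∈ J) (x : ℝ) :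
    HasDerivAt (fun s => g s x) (g t x * Q t x) t := by
  -- A compact time interval around t is what turns the locally uniform Schwartz bounds into one
  -- majorant.
  obtain ⟨ε, hε, hεJ⟩ := Metric.nhds_basis_closedBall.mem_iff.1 (hJ.mem_nhds ht)
  have hK := hv _ hεJ (isCompact_closedBall t ε)
  obtain ⟨D, hD⟩ := hK.norm_le
  have htb : t ∈ Metric.closedBall t ε := Metric.mem_closedBall_self hε.le
  have hsub := Metric.ball_subset_closedBall (x := t) (ε := ε)
  refine _root_.hasDerivAt_of_zeroCurvature (C := max C D) (h := fun t x => star (g t x)) hε huc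
    (fun s => (hg s).hasDerivAt) (fun s => (hg s).hasDerivAt_star (hskew s))
    (fun s y => (hC _ ((hg s).mem_unitary y)).trans (le_max_left _ _))
    (fun s y => by
      rw [norm_star]
      exact (hC _ ((hg s).mem_unitary y)).trans (le_max_left _ _))
    (fun s => (hg s).star_mul) (fun s => (hg s).mul_star) (fun s => (hg s).tendsto)
    (fun s => (hg s).tendsto_star) (fun s hs => hu s (hεJ (hsub hs)))
    (fun s hs y => (hD ⟨s, hsub hs⟩ y).trans
      (mul_le_mul_of_nonneg_right (le_max_right _ _) (by positivity)))
    ((hK 0 0).1 ⟨t, htb⟩).continuous (hQ t ht) (hQ0 t ht) x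

section

variable [CompleteSpace A] (hJ : IsOpen J) (hC : ∀ U ∈ unitary A, ‖U‖ ≤ C)
  (has : star a = -a) (ha : a * a = (-(1 / 4) : ℝ) • 1) (hg : ∀ t, IsFrame (u t) (g t))
  (hu : ∀ t, IsOffDiagonal a (u t)) (hγ : ∀ t x, γ t x = g t x * a * star (g t x))
include hJ hC has ha hg hu hγ

/-- If `u` solves the MNLS with locally uniform Schwartz bounds, then its development solves the
GNLS with locally uniform Schwartz bounds. -/
theorem gnls_of_mnls (hsm : ContDiffOn ℝ ∞ (fun p : ℝ × ℝ => u p.1 p.2) (J ×ˢ univ))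
    (hb : ∀ K ⊆ J, IsCompact K → UniformSchwartz (fun t : K => u t))
    (hflow : ∀ t ∈ J, ∀ x, HasDerivAt (fun s => u s x) (deriv (frameGenerator a (u t)) x +
      (u t x * frameGenerator a (u t) x - frameGenerator a (u t) x * u t x)) t) :
    ContDiffOn ℝ ∞ (fun p : ℝ × ℝ => γ p.1 p.2) (J ×ˢ univ) ∧
    (∀ K ⊆ J, IsCompact K → UniformSchwartz (fun t : K => deriv (γ t))) ∧
    ∀ t ∈ J, ∀ x, HasDerivAt (fun s => γ s x)
      (γ t x * deriv (deriv (γ t)) x - deriv (deriv (γ t)) x * γ t x) t := by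
  have hgt : ∀ t ∈ J, ∀ x, HasDerivAt (fun s => g s x) (g t x * frameGenerator a (u t) x) t :=
    fun t ht x => IsFrame.hasDerivAt_of_zeroCurvature hJ hC hg (fun t => (hu t).skew)
      (fun t => (hu t).smooth.continuous) hflow
      (fun K hK hKc => by
        have h1 := hb K hK hKc
        have h2 : UniformSchwartz (fun t : K => frameGenerator a (u t)) := h1.frameGenerator
        exact h2.deriv.add ((h1.mul_smooth h2.smooth).sub (h2.mul_smooth h1.smooth)))
      (Q := fun t => frameGenerator a (u t))
      (fun t ht x => by
        simpa using ((hu t).smooth.frameGenerator (a := a)).hasDerivAt_infty x)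
      (fun t ht => (uniformSchwartz_at hb ht).frameGenerator.tendsto_atBot ()) ht x
  have hgs : ContDiffOn ℝ ∞ (fun p : ℝ × ℝ => g p.1 p.2) (J ×ˢ univ) :=
    contDiffOn_of_hasDerivAt_mul hJ (hsm.uncurry_frameGenerator hJ) hsm
      (fun t _ x => hC _ ((hg t).mem_unitary x)) hgt (fun t _ => (hg t).hasDerivAt)
  refine ⟨?_, fun K hK hKc => ?_, fun t ht x => ?_⟩
  · simp only [hγ]
    exact (hgs.mul contDiffOn_const).mul ((starL' ℝ : A ≃L[ℝ] A).contDiff.comp_contDiffOn hgs)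
  · have h1 := hb K hK hKc
    have h2 : UniformSmooth (fun t : K => g t) := UniformSmooth.of_hasDerivAt_mul
      (fun t x => hC _ ((hg t).mem_unitary x)) h1 (fun t => (hg t).hasDerivAt)
    rw [show (fun t : K => deriv (γ t)) =
      fun (t : K) x => g t x * ((-2 : ℝ) • (a * u t x)) * star (g t x) from
        funext fun t => funext fun x => (hg t).deriv_eq (hu t) (hγ t) x]
    exact (h2.mul_schwartz (((uniformSmooth_const a).mul_schwartz h1).const_smul (-2))).mul_smooth
      h2.star
  · have hsk : star (frameGenerator a (u t) x) = -frameGenerator a (u t) x :=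
      (hu t).star_frameGenerator has x
    -- Differentiating g a g* in time gives g [Q, a] g* with Q = 2a(u_x + u²), and this commutator
    -- is u_x.
    have h := hasDerivAt_conj (hgt t ht x) (hasDerivAt_star_of_skew hsk (hgt t ht x))
      (hasDerivAt_const t a)
    simp only [← hγ] at h
    refine h.congr_deriv ?_
    rw [zero_add, (hg t).commutator_deriv_deriv_eq (hu t) (hγ t) ha, frameGenerator,
      commutator_lax_base ha ((hu t).anticomm x) ((hu t).deriv_anticomm x)]

/-- If the development `γ` of `u` solves the GNLS with locally uniform Schwartz bounds, then `u`
solves the MNLS with locally uniform Schwartz bounds. -/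
theorem mnls_of_gnls (hs : ∀ t, ContDiff ℝ ∞ (γ t))
    (hsm : ContDiffOn ℝ ∞ (fun p : ℝ × ℝ => γ p.1 p.2) (J ×ˢ univ))
    (hb : ∀ K ⊆ J, IsCompact K → UniformSchwartz (fun t : K => deriv (γ t)))
    (hflow : ∀ t ∈ J, ∀ x, HasDerivAt (fun s => γ s x)
      (γ t x * deriv (deriv (γ t)) x - deriv (deriv (γ t)) x * γ t x) t) :
    ContDiffOn ℝ ∞ (fun p : ℝ × ℝ => u p.1 p.2) (J ×ˢ univ) ∧
    (∀ K ⊆ J, IsCompact K → UniformSchwartz (fun t : K => u t)) ∧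
    ∀ t ∈ J, ∀ x, HasDerivAt (fun s => u s x) (deriv (frameGenerator a (u t)) x +
      (u t x * frameGenerator a (u t) x - frameGenerator a (u t) x * u t x)) t := by
  have hsq : ∀ t x, γ t x * γ t x = (-(1 / 4) : ℝ) • 1 := fun t => (hg t).sq_eq (hγ t) ha
  -- No time regularity of u is available yet, so the ambient connection, smooth in t because γ is,
  -- takes its place, with frame g*.
  have hframe : ∀ t, IsFrame (fun x => -ambientConnection (γ t) x) (fun x => star (g t x)) :=
    fun t => (hg t).star_ambient (hu t) (hγ t) ha
  have hgC : ∀ t x, ‖g t x‖ ≤ C := fun t x => hC _ ((hg t).mem_unitary x)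
  have hsgC : ∀ t x, ‖star (g t x)‖ ≤ C := fun t x => by rw [norm_star]; exact hgC t x
  have hskewA : ∀ t x, star (-ambientConnection (γ t) x) = - -ambientConnection (γ t) x :=
    fun t x => by
      rw [(hg t).ambientConnection_eq (hu t) (hγ t) ha]
      simp [(hu t).skew x, mul_assoc]
  have hskewB : ∀ t x, star (-ambientGenerator (γ t) x) = - -ambientGenerator (γ t) x :=
    fun t x => by
      rw [(hg t).ambientGenerator_eq (hu t) (hγ t) ha]
      simp [(hu t).star_frameGenerator has x, mul_assoc]
  have hγb : ∀ K ⊆ J, IsCompact K → UniformSmooth (fun t : K => γ t) := fun K hK hKc =>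
    UniformSmooth.of_deriv_schwartz (fun t => hs t) (C := C * ‖a‖ * C) (fun t x => by
      rw [hγ]
      exact norm_mul_mul_le_of_le (hgC t x) le_rfl (hsgC t x)) (hb K hK hKc)
  have hAb : ∀ K ⊆ J, IsCompact K → UniformSchwartz (fun t : K => ambientConnection (γ t)) :=
    fun K hK hKc => (hγb K hK hKc).ambientConnection (hb K hK hKc)
  have hBb : ∀ K ⊆ J, IsCompact K → UniformSchwartz (fun t : K => ambientGenerator (γ t)) :=
    fun K hK hKc => (hγb K hK hKc).ambientGenerator (hb K hK hKc)
  have hAt := fun t ht x => hasDerivAt_ambientConnection_flow hJ hsm hs hsq hflow (t := t) ht x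
  have hBx := fun t x => (hs t).ambientGenerator.hasDerivAt_infty x
  -- With A the connection and B the generator, A_t = B_x + [B, A] is zero curvature for the pair
  -- (-A, -B).
  have hsgt : ∀ t ∈ J, ∀ x, HasDerivAt (fun s => star (g s x))
      (star (g t x) * -ambientGenerator (γ t) x) t := fun t ht x =>
    IsFrame.hasDerivAt_of_zeroCurvature hJ hC hframe hskewA
      (fun t => (hs t).ambientConnection.neg.continuous) (fun t ht x => (hAt t ht x).neg)
      (fun K hK hKc => by
        have h1 := hAb K hK hKc
        have h2 := hBb K hK hKc
        exact (h2.deriv.add ((h2.mul_smooth h1.smooth).sub (h1.mul_smooth h2.smooth))).neg)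
      (Q := fun t x => -ambientGenerator (γ t) x)
      (fun t ht x => (hBx t x).neg.congr_deriv (by noncomm_ring))
      (fun t ht =>
        (uniformSchwartz_at (f := fun t => ambientGenerator (γ t)) hBb ht).neg.tendsto_atBot ())
      ht x
  have hsgx := fun t => (hframe t).hasDerivAt
  have hgt : ∀ t ∈ J, ∀ x, HasDerivAt (fun s => g s x)
      (-(-ambientGenerator (γ t) x * g t x)) t := fun t ht x => by
    simpa only [star_star] using hasDerivAt_star_of_skew (hskewB t x) (hsgt t ht x)
  have hgx : ∀ t x, HasDerivAt (g t) (-(-ambientConnection (γ t) x * g t x)) x := fun t x => by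
    simpa only [star_star] using (hframe t).hasDerivAt_star (hskewA t) x
  have hsgs : ContDiffOn ℝ ∞ (fun p : ℝ × ℝ => star (g p.1 p.2)) (J ×ˢ univ) :=
    contDiffOn_of_hasDerivAt_mul (g := fun t x => star (g t x)) hJ
      (hsm.uncurry_ambientGenerator hJ).neg
      (hsm.uncurry_ambientConnection hJ).neg (fun t _ => hsgC t) hsgt (fun t _ => hsgx t)
  have hgs : ContDiffOn ℝ ∞ (fun p : ℝ × ℝ => g p.1 p.2) (J ×ˢ univ) := by
    simpa only [Function.comp_def, starL'_apply, star_star] using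
      (starL' ℝ : A ≃L[ℝ] A).contDiff.comp_contDiffOn hsgs
  have hueq : ∀ t x, u t x = star (g t x) * ambientConnection (γ t) x * g t x := fun t =>
    (hg t).eq_conj_ambientConnection (hu t) (hγ t) ha
  have hQeq : ∀ t, frameGenerator a (u t) =
      fun x => star (g t x) * ambientGenerator (γ t) x * g t x := fun t => funext fun x => by
    rw [(hg t).ambientGenerator_eq (hu t) (hγ t) ha]
    have h : star (g t x) * (g t x * frameGenerator a (u t) x * star (g t x)) * g t x =
      (star (g t x) * g t x) * frameGenerator a (u t) x * (star (g t x) * g t x) := by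
      simp only [mul_assoc]
    rw [h, (hg t).star_mul, one_mul, mul_one]
  refine ⟨?_, fun K hK hKc => ?_, fun t ht x => ?_⟩
  · simp only [hueq]
    exact (hsgs.mul (hsm.uncurry_ambientConnection hJ)).mul hgs
  · have h1 := hAb K hK hKc
    have h2 : UniformSmooth (fun (t : K) x => star (g t x)) :=
      UniformSmooth.of_hasDerivAt_mul (fun t => hsgC t) h1.neg (fun t => hsgx t)
    have h3 : UniformSmooth (fun t : K => g t) := by
      simpa only [star_star] using h2.star
    rw [show (fun t : K => u t) = fun (t : K) x => star (g t x) * ambientConnection (γ t) x * g t x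
      from funext fun t => funext (hueq t)]
    exact (h2.mul_schwartz h1).mul_smooth h3
  -- For u = g*Ag and Q = g*Bg: u_t = g*(A_t - [B, A])g = g*B_x g, while Q_x = g*B_x g - [u, Q].
  -- Comparing the two gives the MNLS.
  · have h1 := hasDerivAt_conj (hsgt t ht x) (hgt t ht x) (hAt t ht x)
    have h2 := hasDerivAt_conj (hsgx t x) (hgx t x) (hBx t x)
    rw [← hQeq] at h2
    rw [h2.deriv, hQeq]
    simp only [← hueq] at h1
    refine h1.congr_deriv ?_
    beta_reduce
    rw [hueq t x, conj_mul_conj ((hg t).mul_star x), conj_mul_conj ((hg t).mul_star x)]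
    noncomm_ring

end

end Flows

-- The matrix model: base point, centralizer and Q₂

attribute [local instance] Matrix.frobeniusNormedRing Matrix.frobeniusNormedAlgebra

namespace GrMat

variable {k m : ℕ}

theorem star_base : star (base k m) = -base k m := by
  rw [star_eq_conjTranspose, base, conjTranspose_smul, fromBlocks_conjTranspose]
  have h : star (Complex.I / 2) = -(Complex.I / 2) := by simp [neg_div]
  rw [h]
  simp

theorem base_mul_base : base k m * base k m = (-(1 / 4) : ℝ) • 1 := by
  have h : Complex.I / 2 * (Complex.I / 2) = ((-(1 / 4) : ℝ) : ℂ) := by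
    rw [div_mul_div_comm, Complex.I_mul_I]; push_cast; norm_num
  rw [base, smul_mul_smul_comm, h, fromBlocks_multiply, Complex.coe_smul]
  simp [fromBlocks_one]

open scoped ComplexOrder in
-- Conjugation by 2a is the isometric involution y ↦ -4aya, whose +1 and -1 eigenspaces in u(n) are
-- the centralizer and its orthogonal complement.
theorem mem_centralizerPerp_iff {y : GrMat k m} :
    y ∈ centralizerPerp k m ↔ star y = -y ∧ y * base k m = -(base k m * y) := by
  have haa := base_mul_base (k := k) (m := m)
  have haa' := mul_mul_cancel_quarter haa
  set a := base k m with ha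
  constructor
  · rintro ⟨hy, hz⟩
    refine ⟨hy, ?_⟩
    have hy' : star y = -y := hy
    -- Twice the projection of y to the centralizer. Cyclicity gives tr(zz) = 2 tr(yz) = 0, so z = 0
    -- by definiteness of the trace form.
    let z : GrMat k m := y - (4 : ℝ) • (a * (y * a))
    have hza : z * a = a * z := by
      simp only [z, sub_mul, mul_sub, smul_mul_assoc, mul_smul_comm, mul_assoc, haa, haa', mul_one]
      module
    have hzs : star z = -z := by
      simp only [z, star_sub, star_smul, star_mul, hy', ha, star_base, star_trivial, mul_neg,
        neg_mul, neg_neg, mul_assoc]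
      module
    have hz0 := hz z ⟨hzs, by rw [Ring.lie_def, sub_eq_zero]; exact hza⟩
    rw [neg_eq_zero] at hz0
    have htr : (star z * z).trace = 0 := by
      have h1 : (a * (y * a) * z).trace = -(1 / 4 : ℝ) • (y * z).trace := by
        rw [show a * (y * a) * z = a * (y * (a * z)) by simp only [mul_assoc], trace_mul_comm,
          ← hza, show y * (z * a) * a = y * (z * (a * a)) by simp only [mul_assoc], haa,
          mul_smul_comm, mul_smul_comm, mul_one, trace_smul]
      rw [hzs, neg_mul, trace_neg]
      nth_rw 1 [show z = y - (4 : ℝ) • (a * (y * a)) from rfl]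
      rw [sub_mul, smul_mul_assoc, trace_sub, trace_smul, h1, hz0]
      simp
    have hz00 : z = 0 := trace_conjTranspose_mul_self_eq_zero_iff.1 htr
    have hy4 : y = (4 : ℝ) • (a * (y * a)) := sub_eq_zero.1 hz00
    have : a * y = (-1 : ℝ) • (y * a) := by
      conv_lhs => rw [hy4]
      rw [mul_smul_comm, haa', smul_smul]; norm_num
    rw [this]; module
  · rintro ⟨hy, hya⟩
    refine ⟨hy, fun z hz => ?_⟩
    have hza : z * a = a * z := by
      have := hz.2
      rwa [Ring.lie_def, sub_eq_zero] at this
    have h1 : (y * z).trace = -(y * z).trace := by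
      have h2 : y = (4 : ℝ) • (a * (y * a)) := by
        rw [hya, mul_neg, haa']; module
      have h3 : (a * (y * a) * z).trace = -(1 / 4 : ℝ) • (y * z).trace := by
        rw [show a * (y * a) * z = a * (y * (a * z)) by simp only [mul_assoc], trace_mul_comm,
          ← hza, show y * (z * a) * a = y * (z * (a * a)) by simp only [mul_assoc], haa,
          mul_smul_comm, mul_smul_comm, mul_one, trace_smul]
      conv_lhs => rw [h2]
      rw [smul_mul_assoc, trace_smul, h3, smul_smul]
      norm_num
    rw [self_eq_neg.1 h1, neg_zero]

theorem norm_le_of_mem_unitary {U : GrMat k m} (hU : U ∈ unitary (GrMat k m)) :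
    ‖U‖ ≤ (∑ _i : Fin k ⊕ Fin m, ∑ _j : Fin k ⊕ Fin m, (1 : ℝ)) ^ (1 / 2 : ℝ) := by
  rw [frobenius_norm_def]
  refine Real.rpow_le_rpow (by positivity) (Finset.sum_le_sum fun i _ => Finset.sum_le_sum
    fun j _ => ?_) (by norm_num)
  exact Real.rpow_le_one (norm_nonneg _) (entry_norm_bound_of_unitary hU i j) (by norm_num)

theorem eq_fromBlocks_of_anticomm {y : GrMat k m} (hs : star y = -y)
    (hy : y * base k m = -(base k m * y)) :
    y = fromBlocks 0 y.toBlocks₁₂ (-y.toBlocks₁₂ᴴ) 0 := by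
  have h2 : (Complex.I / 2) ≠ 0 := by simp
  have hy' : y * fromBlocks 1 0 0 (-1) = -(fromBlocks 1 0 0 (-1) * y) := by
    rw [base, mul_smul_comm, smul_mul_assoc, ← smul_neg] at hy
    exact smul_right_injective _ h2 hy
  rw [star_eq_conjTranspose] at hs
  rw [← fromBlocks_toBlocks y] at hy' hs
  rw [fromBlocks_multiply, fromBlocks_multiply, fromBlocks_neg, fromBlocks_inj] at hy'
  rw [fromBlocks_conjTranspose, fromBlocks_neg, fromBlocks_inj] at hs
  obtain ⟨h11, -, -, h22⟩ := hy'
  conv_lhs => rw [← fromBlocks_toBlocks y]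
  rw [fromBlocks_inj]
  refine ⟨?_, rfl, ?_, ?_⟩
  · have h : y.toBlocks₁₁ = -y.toBlocks₁₁ := by simpa using h11
    exact Matrix.ext fun i j => self_eq_neg.1 (congrFun₂ h i j)
  · rw [hs.2.2.1, neg_neg]
  · have h : y.toBlocks₂₂ = -y.toBlocks₂₂ := by simpa [eq_comm] using h22
    exact Matrix.ext fun i j => self_eq_neg.1 (congrFun₂ h i j)

/-- Here 2a = i diag(1, -1), u² = diag(-qq*, -q*q), and u_x is off-diagonal with blocks q_x, -q_x*.
-/
theorem Q2_eq_frameGenerator {u : ℝ → GrMat k m} (hu : IsOffDiagonal (base k m) u) :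
    Q2 u = frameGenerator (base k m) u := by
  funext x
  let T : GrMat k m →ₗ[ℝ] Matrix (Fin k) (Fin m) ℂ :=
    { toFun := fun y => y.toBlocks₁₂, map_add' := fun _ _ => rfl, map_smul' := fun _ _ => rfl }
  have hd : deriv (fun y => (u y).toBlocks₁₂) x = (deriv u x).toBlocks₁₂ :=
    (T.toContinuousLinearMap.hasFDerivAt.comp_hasDerivAt x (hu.smooth.hasDerivAt_infty x)).deriv
  have h1 := eq_fromBlocks_of_anticomm (hu.skew x) (hu.anticomm x)
  have h2 := eq_fromBlocks_of_anticomm (hu.deriv_skew x) (hu.deriv_anticomm x)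
  rw [Q2, frameGenerator, hd]
  have hI : ((2 : ℝ) : ℂ) * (Complex.I / 2) = Complex.I := by push_cast; ring
  rw [h1, h2, base, fromBlocks_multiply, fromBlocks_add, smul_mul_assoc, fromBlocks_multiply,
    ← Complex.coe_smul, smul_smul, hI, fromBlocks_smul]
  simp
  rfl

end GrMat

/-! ### Grassmannian paths and their developments -/

open GrMat

variable {k m : ℕ}

namespace GrPath

theorem ext_of_eq {γ γ' : GrPath k m} (h : ∀ x, γ x = γ' x) : γ = γ' := by
  cases γ; cases γ'
  congr
  exact funext h

theorem sq_eq (γ : GrPath k m) (x : ℝ) : γ x * γ x = (-(1 / 4) : ℝ) • 1 := by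
  obtain ⟨U, hU, h⟩ := γ.mem_orbit x
  rw [h, ← star_eq_conjTranspose, conj_mul_conj (mem_unitaryGroup_iff'.1 hU), base_mul_base, mul_smul_comm, smul_mul_assoc,
    mul_one, mem_unitaryGroup_iff.1 hU]

theorem star_eq (γ : GrPath k m) (x : ℝ) : star (γ x) = -γ x := by
  obtain ⟨U, -, h⟩ := γ.mem_orbit x
  rw [h, ← star_eq_conjTranspose, StarMul.star_mul, StarMul.star_mul, star_star, star_base]
  noncomm_ring

theorem norm_le (γ : GrPath k m) (x : ℝ) :
    ‖γ x‖ ≤ (∑ _i : Fin k ⊕ Fin m, ∑ _j : Fin k ⊕ Fin m, (1 : ℝ)) ^ (1 / 2 : ℝ) * ‖base k m‖ *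
      (∑ _i : Fin k ⊕ Fin m, ∑ _j : Fin k ⊕ Fin m, (1 : ℝ)) ^ (1 / 2 : ℝ) := by
  obtain ⟨U, hU, h⟩ := γ.mem_orbit x
  rw [h]
  exact norm_mul_mul_le_of_le (norm_le_of_mem_unitary hU) le_rfl
    (by rw [← star_eq_conjTranspose, norm_star]; exact norm_le_of_mem_unitary hU)

theorem uniformSchwartz_deriv (γ : GrPath k m) :
    UniformSchwartz (fun _ : Unit => deriv γ) := by
  obtain ⟨f, hf⟩ := γ.deriv_schwartz
  rw [← show ⇑f = deriv γ from funext hf]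
  exact f.uniformSchwartz

theorem uniformSchwartz_ambientConnection (γ : GrPath k m) :
    UniformSchwartz (fun _ : Unit => ambientConnection γ) :=
  (UniformSmooth.of_deriv_schwartz (fun _ => γ.smooth) (fun _ => γ.norm_le)
    γ.uniformSchwartz_deriv).ambientConnection γ.uniformSchwartz_deriv

theorem star_ambientConnection (γ : GrPath k m) (x : ℝ) :
    star (ambientConnection γ x) = -ambientConnection γ x :=
  star_ambientConnection_of_skew γ.smooth γ.star_eq x

end GrPath

theorem PerpSchwartz.isOffDiagonal (u : PerpSchwartz k m) : IsOffDiagonal (base k m) u where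
  skew x := (mem_centralizerPerp_iff.1 (u.2 x)).1
  anticomm x := (mem_centralizerPerp_iff.1 (u.2 x)).2
  smooth := u.1.smooth'

theorem isDevelopment_iff {γ : GrPath k m} {u : PerpSchwartz k m} :
    IsDevelopment γ u ↔ ∃ g, IsFrame u g ∧ ∀ x, γ x = g x * base k m * star (g x) := by
  constructor
  · rintro ⟨g, hs, hU, hl, hd, hγ⟩
    refine ⟨g, ⟨fun x => ?_, fun x => mem_unitaryGroup_iff'.1 (hU x),
      fun x => mem_unitaryGroup_iff.1 (hU x), hl⟩, hγ⟩
    have h : deriv g x = g x * u x := by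
      rw [← hd, ← mul_assoc, ← star_eq_conjTranspose, mem_unitaryGroup_iff.1 (hU x), one_mul]
    exact (hs.hasDerivAt_infty x).congr_deriv h
  · rintro ⟨g, hg, hγ⟩
    refine ⟨g, hg.contDiff u.1.smooth', hg.mem_unitary, hg.tendsto, fun x => ?_, hγ⟩
    have h : deriv g x = g x * u x := (hg.hasDerivAt x).deriv
    have h' : star (g x) * (g x * u x) = u x := by rw [← mul_assoc, hg.star_mul, one_mul]
    exact (congrArg (star (g x) * ·) h).trans h'

/-- Both adjoint frames belong to -[γ, γ_x], so they agree, and u is [γ, γ_x] conjugated by the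
common frame. -/
theorem IsDevelopment.unique_right {γ : GrPath k m} {u v : PerpSchwartz k m}
    (hu : IsDevelopment γ u) (hv : IsDevelopment γ v) : u = v := by
  obtain ⟨g, hg, hγ⟩ := isDevelopment_iff.1 hu
  obtain ⟨h, hh, hγ'⟩ := isDevelopment_iff.1 hv
  have h1 := (hg.star_ambient u.isOffDiagonal hγ base_mul_base).unique
    (hh.star_ambient v.isOffDiagonal hγ' base_mul_base)
    (fun x => by rw [star_neg, γ.star_ambientConnection])
  refine Subtype.ext (DFunLike.ext _ _ fun x => ?_)
  have h2 : g x = h x := star_injective (congrFun h1 x)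
  rw [hg.eq_conj_ambientConnection u.isOffDiagonal hγ base_mul_base x,
    hh.eq_conj_ambientConnection v.isOffDiagonal hγ' base_mul_base x, h2]

theorem IsDevelopment.unique_left {γ γ' : GrPath k m} {u : PerpSchwartz k m}
    (hu : IsDevelopment γ u) (hu' : IsDevelopment γ' u) : γ = γ' := by
  obtain ⟨g, hg, hγ⟩ := isDevelopment_iff.1 hu
  obtain ⟨h, hh, hγ'⟩ := isDevelopment_iff.1 hu'
  refine GrPath.ext_of_eq fun x => ?_
  rw [hγ, hγ', hg.unique hh u.isOffDiagonal.skew]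

theorem exists_isDevelopment (γ : GrPath k m) : ∃ u : PerpSchwartz k m, IsDevelopment γ u := by
  have hA := γ.uniformSchwartz_ambientConnection
  have hskew : ∀ x, star (-ambientConnection γ x) = - -ambientConnection γ x := fun x => by
    rw [star_neg, γ.star_ambientConnection]
  have hAn := hA.neg
  obtain ⟨C, hC⟩ := hAn.norm_le
  have hAs : ContDiff ℝ ∞ (fun x => -ambientConnection γ x) := (hAn 0 0).1 ()
  obtain ⟨h, hh⟩ := IsFrame.exists_of_norm_le hAs.continuous hskew (hC ())
  have hhs := hh.hasDerivAt_star hskew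
  -- Parallelism makes h γ h* constant; its value is read off at -∞, where h → 1 and γ → a.
  have hha : ∀ x, h x * γ x * star (h x) = base k m := eq_of_hasDerivAt_zero_of_tendsto
    (fun x => (hasDerivAt_conj (hh.hasDerivAt x) (hhs x)
      (γ.smooth.hasDerivAt_infty x)).congr_deriv (by
        rw [deriv_add_commutator_neg_ambientConnection γ.smooth γ.sq_eq, mul_zero, zero_mul]))
    (by simpa using (hh.tendsto.mul γ.tendsto_atBot).mul hh.tendsto_star)
  have hhb : UniformSmooth (fun _ : Unit => h) := UniformSmooth.of_hasDerivAt_mul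
    (fun _ x => norm_le_of_mem_unitary (hh.mem_unitary x)) hAn (fun _ => hh.hasDerivAt)
  have hu : UniformSchwartz (fun (_ : Unit) x => h x * ambientConnection γ x * star (h x)) :=
    (hhb.mul_schwartz hA).mul_smooth hhb.star
  -- The frame of u is g = h*, and u is [γ, γ_x] transported by h; it anticommutes with a because
  -- [γ, γ_x] anticommutes with γ = h* a h.
  refine ⟨⟨hu.toSchwartzMap (), fun x => ?_⟩, isDevelopment_iff.2 ⟨fun x => star (h x), ?_, ?_⟩⟩
  · refine mem_centralizerPerp_iff.2 ⟨?_, ?_⟩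
    · change star (h x * ambientConnection γ x * star (h x)) =
        -(h x * ambientConnection γ x * star (h x))
      rw [StarMul.star_mul, StarMul.star_mul, star_star, γ.star_ambientConnection]
      noncomm_ring
    · change h x * ambientConnection γ x * star (h x) * base k m =
        -(base k m * (h x * ambientConnection γ x * star (h x)))
      rw [← hha x, conj_mul_conj (hh.star_mul x), conj_mul_conj (hh.star_mul x),
        ambientConnection_mul_self γ.smooth γ.sq_eq, mul_neg, neg_mul]
  · have h1 := hh.adjoint hskew
    convert h1 using 1
    funext x
    change h x * ambientConnection γ x * star (h x) = _
    noncomm_ring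
  · intro x
    rw [← hha x, star_star]
    have h3 : star (h x) * (h x * γ x * star (h x)) * h x =
      (star (h x) * h x) * γ x * (star (h x) * h x) := by simp only [mul_assoc]
    rw [h3, hh.star_mul, one_mul, mul_one]

theorem exists_isDevelopment_of_perp (u : PerpSchwartz k m) :
    ∃ γ : GrPath k m, IsDevelopment γ u := by
  have hu := u.isOffDiagonal
  have hus : UniformSchwartz (fun _ : Unit => (u : ℝ → GrMat k m)) := u.1.uniformSchwartz
  obtain ⟨C, hC⟩ := hus.norm_le
  obtain ⟨g, hg⟩ := IsFrame.exists_of_norm_le hu.smooth.continuous hu.skew (hC ())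
  have hgs : ContDiff ℝ ∞ g := hg.contDiff hu.smooth
  have hgb : UniformSmooth (fun _ : Unit => g) := UniformSmooth.of_hasDerivAt_mul
    (fun _ x => norm_le_of_mem_unitary (hg.mem_unitary x)) hus (fun _ => hg.hasDerivAt)
  have hd : UniformSchwartz
      (fun (_ : Unit) x => g x * ((-2 : ℝ) • (base k m * u x)) * star (g x)) :=
    (hgb.mul_schwartz (((uniformSmooth_const (base k m)).mul_schwartz hus).const_smul
      (-2))).mul_smooth hgb.star
  refine ⟨⟨fun x => g x * base k m * star (g x), ?_, fun x => ⟨g x, hg.mem_unitary x, rfl⟩, ?_,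
    hd.toSchwartzMap (), fun x => ?_⟩, isDevelopment_iff.2 ⟨g, hg, fun x => rfl⟩⟩
  · exact (hgs.mul contDiff_const).mul ((starL' ℝ : GrMat k m ≃L[ℝ] GrMat k m).contDiff.comp hgs)
  · have h := (hg.tendsto.mul_const (base k m)).mul hg.tendsto_star
    rw [one_mul, mul_one] at h
    exact h
  · exact (hg.deriv_eq hu (fun _ => rfl) x).symm

theorem developmentMap_eq_iff (γ : GrPath k m) (u : PerpSchwartz k m) :
    developmentMap γ = u ↔ IsDevelopment γ u := by
  have h : IsDevelopment γ (developmentMap γ) := Classical.epsilon_spec (exists_isDevelopment γ)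
  exact ⟨fun hu => hu ▸ h, fun hu => h.unique_right hu⟩

theorem developmentMap_bijective :
    Function.Bijective (developmentMap : GrPath k m → PerpSchwartz k m) := by
  refine ⟨fun γ γ' h => ?_, fun u => ?_⟩
  · exact ((developmentMap_eq_iff γ _).1 h).unique_left ((developmentMap_eq_iff γ' _).1 rfl)
  · obtain ⟨γ, hγ⟩ := exists_isDevelopment_of_perp u
    exact ⟨γ, (developmentMap_eq_iff γ u).2 hγ⟩

/-! ### Equivalence of GNLS and MNLS solutions -/

theorem locallyBoundedSchwartz_iff {J : Set ℝ} {f : ℝ → ℝ → GrMat k m}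
    (hf : ∀ t, ContDiff ℝ ∞ (f t)) :
    LocallyBoundedSchwartz J f ↔ ∀ K ⊆ J, IsCompact K → UniformSchwartz (fun t : K => f t) := by
  constructor
  · intro h K hK hKc p l
    refine ⟨fun t => hf t, fun j _ => ?_⟩
    obtain ⟨C, hC⟩ := h K hK hKc p j
    exact ⟨C, fun t => hC t t.2⟩
  · intro h K hK hKc p l
    obtain ⟨C, hC⟩ := (h K hK hKc p l).2 l le_rfl
    exact ⟨C, fun t ht => hC ⟨t, ht⟩⟩

theorem theorem3p10 (k m : ℕ) :
    Function.Bijective (developmentMap : GrPath k m → PerpSchwartz k m) ∧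
    (∀ (γ : GrPath k m) (u : PerpSchwartz k m), developmentMap γ = u ↔ IsDevelopment γ u) ∧
    ∀ (J : Set ℝ), IsOpen J → ∀ γ : ℝ → GrPath k m,
      IsGNLSSolution J γ ↔ IsMNLSSolution J (fun t => developmentMap (γ t)) := by
  refine ⟨developmentMap_bijective, developmentMap_eq_iff, fun J hJ γ => ?_⟩
  have hdev := fun t => isDevelopment_iff.1 ((developmentMap_eq_iff (γ t) _).1 rfl)
  -- The frames are chosen separately for each t; their regularity in t comes out of the flow
  -- lemmas.
  choose g hg hγ using hdev
  have hu := fun t => (developmentMap (γ t)).isOffDiagonal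
  have hγs := fun t => (γ t).smooth
  have hlb := locallyBoundedSchwartz_iff (J := J) (f := fun t => deriv (γ t))
    fun t => contDiff_deriv (hγs t)
  have hlb' := locallyBoundedSchwartz_iff (J := J) (f := fun t => developmentMap (γ t))
    fun t => (hu t).smooth
  have hder : ∀ f : ℝ → GrMat k m, iteratedDeriv 2 f = deriv (deriv f) := fun f => by
    rw [iteratedDeriv_succ, iteratedDeriv_one]
    rfl
  constructor
  · rintro ⟨h1, h2, h3⟩
    obtain ⟨h4, h5, h6⟩ := mnls_of_gnls hJ (fun U hU => norm_le_of_mem_unitary hU) star_base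
      base_mul_base hg hu hγ hγs h1 (hlb.1 h2) (fun t ht x => by
        have h := h3 t ht x
        rw [hder, Ring.lie_def] at h
        exact h)
    exact ⟨h4, hlb'.2 h5, fun t ht x => by
      rw [Q2_eq_frameGenerator (hu t), Ring.lie_def]
      exact h6 t ht x⟩
  · rintro ⟨h1, h2, h3⟩
    obtain ⟨h4, h5, h6⟩ := gnls_of_mnls hJ (fun U hU => norm_le_of_mem_unitary hU) star_base
      base_mul_base hg hu hγ h1 (hlb'.1 h2) (fun t ht x => by
        have h := h3 t ht x
        rw [Q2_eq_frameGenerator (hu t), Ring.lie_def] at h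
        exact h)
    exact ⟨h4, hlb.2 h5, fun t ht x => by
      rw [hder, Ring.lie_def]
      exact h6 t ht x⟩
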